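/- Consider a set of $n\ge 1$ agents and a set $M$ of $m$ indivisible items. Agent $i$ has an additive valuation $V_i(S)=\sum_{b\in S}V_i(\{b\})$ with $V_i(\{b\})\ge 0$, and $w_{j,i}\ge 0$ is the influence of agent $j$ on agent $i$, normalized so that $\sum_j w_{j,i}=1$ for every $i$; all $V_i(\{b\})$ and $w_{j,i}$ are rational numbers, given in binary. If agent $j$ receives the bundle $A_j$ for every $j$, the utility of agent $i$ is $\sum_j w_{j,i}V_i(A_j)$. The extended-maximin-share of agent $i$ is $$\mathsf{EMMS}_i=\max_{P}\ \min_{\sigma}\ \sum_{k=1}^n w_{\sigma(k),i}\,V_i(P_k),$$ where $P=\langle P_1,\dots,P_n\rangle$ ranges over the partitions of $M$ into $n$ (possibly empty) bundles and $\sigma$ over the bijections from $\{1,\dots,n\}$ to the agents. For a real number $c$, an allocation of all the items is a $c$-$\mathsf{EMMS}$ allocation if every agent $i$ has utility at least $c\cdot\mathsf{EMMS}_i$ in it. There is a polynomial-time algorithm (in the bit length of the instance) which, for every real $\alpha$ and every such instance with $w_{i,i}\ge\alpha$ for every agent $i$, outputs an $(\alpha/4)$-$\mathsf{EMMS}$ allocation.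 -/

import Mathlib

/-! ## The network externalities model -/

namespace NetworkExternalities

/-- A fair allocation instance in the network externalities model, with agents `Fin n`, indivisible
items `Fin m` and rational data (so that instances are finite objects). -/
structure AllocInstance where
  /-- the number of agents -/
  n : ℕ
  /-- the number of items -/
  m : ℕ
  n_pos : 0 < n
  /-- `value i b` is the value of item `b` for agent `i` -/
  value : Fin n → Fin m → ℚ
  /-- `weight j i` is the weight `w_{j,i}` of the edge from `j` to `i` of the influence graph,
  the influence of agent `j` on agent `i` -/
  weight : Fin n → Fin n → ℚ
  value_nonneg : ∀ i b, 0 ≤ value i b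
  weight_nonneg : ∀ j i, 0 ≤ weight j i
  weight_sum : ∀ i, ∑ j, weight j i = 1

namespace AllocInstance

variable (I : AllocInstance)

/-- A partition of the items into `n` (possibly empty) bundles, given by the index of the
bundle of every item. -/
abbrev Partition : Type := Fin I.m → Fin I.n

variable {I}

/-- The `k`-th bundle of a partition. -/
def Partition.bundle (P : I.Partition) (k : Fin I.n) : Finset (Fin I.m) :=
  Finset.univ.filter fun b => P b = k

variable (I)

/-- The (additive) value of a set of items for agent `i`. -/
def setValue (i : Fin I.n) (S : Finset (Fin I.m)) : ℚ := ∑ b ∈ S, I.value i b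

/-- The utility of agent `i` when the bundles of `P` are distributed, one to each agent, by giving
the `k`-th bundle to agent `σ k`. -/
def utility (i : Fin I.n) (P : I.Partition) (σ : Equiv.Perm (Fin I.n)) : ℚ :=
  ∑ k, I.setValue i (P.bundle k) * I.weight (σ k) i

/-- The utility of agent `i` in the worst allocation of the bundles of `P` for him. -/
def worstUtility (i : Fin I.n) (P : I.Partition) : ℚ :=
  Finset.univ.inf' Finset.univ_nonempty (I.utility i P)

instance : Nonempty I.Partition := ⟨fun _ => ⟨0, I.n_pos⟩⟩

/-- The extended-maximin-share of agent `i`. -/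
def EMMS (i : Fin I.n) : ℚ :=
  Finset.univ.sup' Finset.univ_nonempty (I.worstUtility i)

/-- Agent `i` is `β`-self-reliant. -/
def SelfReliant (β : ℝ) (i : Fin I.n) : Prop := β ≤ I.weight i i

/-- The allocation that gives every item `b` to agent `A b` (so agent `k` owns the `k`-th bundle)
guarantees every agent the fraction `c` of his extended-maximin-share. -/
def IsEMMSAllocation (c : ℝ) (A : Fin I.m → Fin I.n) : Prop :=
  ∀ i, c * (I.EMMS i : ℝ) ≤ (I.utility i A (Equiv.refl _) : ℝ)

end AllocInstance

end NetworkExternalities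

/-! ## A random access machine with a step count

Programs are structured: registers and arrays hold natural numbers of arbitrary size, arrays are
addressed indirectly, the arithmetic operations are addition and truncated subtraction, and every
elementary operation costs one unit. There is no multiplication, so one operation lengthens
the longest binary numeral by at most one bit; hence polynomial time on this machine is polynomial
time on Turing machines. -/

namespace RAM

/-- A memory state: `reg x` is the content of register `x`, and `mem a k` that of cell `k` of
array `a`. A program mentions only finitely many registers and arrays. -/
structure State where
  reg : ℕ → ℕ
  mem : ℕ → ℕ → ℕ

/-- Arithmetic expressions. -/
inductive Expr
  /-- a constant -/
  | const (c : ℕ)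
  /-- the content of a register -/
  | reg (x : ℕ)
  /-- `cell a e`: the content of array `a` at the address `e` -/
  | cell (a : ℕ) (e : Expr)
  /-- a sum -/
  | add (e f : Expr)
  /-- a truncated difference -/
  | sub (e f : Expr)

/-- The value of an expression. -/
def Expr.eval (s : State) : Expr → ℕ
  | .const c => c
  | .reg x => s.reg x
  | .cell a e => s.mem a (e.eval s)
  | .add e f => e.eval s + f.eval s
  | .sub e f => e.eval s - f.eval s

/-- The cost of evaluating an expression: one unit for each of its nodes. -/
def Expr.cost : Expr → ℕ
  | .const _ => 1
  | .reg _ => 1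
  | .cell _ e => e.cost + 1
  | .add e f => e.cost + f.cost + 1
  | .sub e f => e.cost + f.cost + 1

/-- Programs. -/
inductive Prog
  /-- do nothing -/
  | skip
  /-- `assign x e`: write the value of `e` into register `x` -/
  | assign (x : ℕ) (e : Expr)
  /-- `store a e f`: write the value of `f` into array `a` at the address `e` -/
  | store (a : ℕ) (e f : Expr)
  /-- sequential composition -/
  | seq (p q : Prog)
  /-- `branch e f p q`: if `e < f` run `p`, otherwise run `q` -/
  | branch (e f : Expr) (p q : Prog)
  /-- `loop e f p`: while `e < f` run `p` -/
  | loop (e f : Expr) (p : Prog)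

/-- Write `v` into register `x`. -/
def State.setReg (s : State) (x v : ℕ) : State :=
  { s with reg := Function.update s.reg x v }

/-- Write `v` into cell `k` of array `a`. -/
def State.setMem (s : State) (a k v : ℕ) : State :=
  { s with mem := Function.update s.mem a (Function.update (s.mem a) k v) }

/-- `Runs p s t s'`: started in state `s`, the program `p` halts in state `s'` after exactly `t`
steps. -/
inductive Runs : Prog → State → ℕ → State → Prop
  | skip (s : State) : Runs .skip s 1 s
  | assign (s : State) (x : ℕ) (e : Expr) :
      Runs (.assign x e) s (e.cost + 1) (s.setReg x (e.eval s))
  | store (s : State) (a : ℕ) (e f : Expr) :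
      Runs (.store a e f) s (e.cost + f.cost + 1) (s.setMem a (e.eval s) (f.eval s))
  | seq {p q : Prog} {s s' s'' : State} {t t' : ℕ} :
      Runs p s t s' → Runs q s' t' s'' → Runs (.seq p q) s (t + t') s''
  | branch_true {e f : Expr} {p q : Prog} {s s' : State} {t : ℕ} :
      e.eval s < f.eval s → Runs p s t s' →
        Runs (.branch e f p q) s (e.cost + f.cost + 1 + t) s'
  | branch_false {e f : Expr} {p q : Prog} {s s' : State} {t : ℕ} :
      ¬ e.eval s < f.eval s → Runs q s t s' →
        Runs (.branch e f p q) s (e.cost + f.cost + 1 + t) s'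
  | loop_true {e f : Expr} {p : Prog} {s s' s'' : State} {t t' : ℕ} :
      e.eval s < f.eval s → Runs p s t s' → Runs (.loop e f p) s' t' s'' →
        Runs (.loop e f p) s (e.cost + f.cost + 1 + t + t') s''
  | loop_false {e f : Expr} {p : Prog} {s : State} :
      ¬ e.eval s < f.eval s → Runs (.loop e f p) s (e.cost + f.cost + 1) s

end RAM

/-! ## Instances as inputs, allocations as outputs -/

namespace NetworkExternalities

/-- The number of binary digits of the numerator and the denominator (in lowest terms) of a
rational number. -/
def ratSize (q : ℚ) : ℕ := Nat.size q.num.natAbs + Nat.size q.den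

/-- The content of an array that holds the matrix `M` row by row, starting at address `0`:
the entry in row `i` and column `j` is at address `c * i + j`. -/
def rowMajor {r c : ℕ} (M : Fin r → Fin c → ℕ) (k : ℕ) : ℕ :=
  if h : k < r * c then
    M (finProdFinEquiv.symm ⟨k, h⟩).1 (finProdFinEquiv.symm ⟨k, h⟩).2
  else 0

namespace AllocInstance

variable (I : AllocInstance)

/-- The length of the binary description of an instance. Denominators have at least one digit,
so it is at least the number of entries of the two matrices. -/
def size : ℕ :=
  Nat.size I.n + Nat.size I.m + (∑ i, ∑ b, ratSize (I.value i b))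
    + ∑ j, ∑ i, ratSize (I.weight j i)

/-- The state in which a program is started on an instance: `n` and `m` in the registers `0` and
`1`, numerators and denominators of the values in the arrays `0` and `1`, those of the weights
in the arrays `2` and `3`, and zero everywhere else. -/
def input : RAM.State where
  reg x := match x with
    | 0 => I.n
    | 1 => I.m
    | _ => 0
  mem a := match a with
    | 0 => rowMajor fun i b => (I.value i b).num.natAbs
    | 1 => rowMajor fun i b => (I.value i b).den
    | 2 => rowMajor fun j i => (I.weight j i).num.natAbs
    | 3 => rowMajor fun j i => (I.weight j i).den
    | _ => fun _ => 0

/-- The state `s` presents the allocation `A`: cell `b` of array `4` holds the agent who gets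
item `b`. -/
def Outputs (s : RAM.State) (A : Fin I.m → Fin I.n) : Prop :=
  ∀ b : Fin I.m, s.mem 4 b = (A b : ℕ)

end AllocInstance

end NetworkExternalities

/-! The algorithm ignores the influence weights. Let an allocation give fewer than `n` items,
forming a set T, to distinct agents, and let S be the contribution of T to the utility of agent i.
For every partition P, the worst utility of i is at most S + V_i(Tᶜ)/(n - |T|) (`worstUtility_le`).
To see this, distribute the bundles of P at random: a bundle with an item of T whose owner has
weight at most 1/(n - |T|) goes to the least influential such owner, and the other bundles are
spread evenly over the remaining agents. By Birkhoff's theorem some permutation gives at most this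
average.

Suppose moreover that T avoids the bundle of i, whose value is x, and that V_i(Tᶜ) ≤ 4(n - |T|)x.
Then EMMS_i ≤ S + 4x, while i has utility at least S + w_{i,i}x ≥ (w_{i,i}/4)(S + 4x). This is
`isEMMSAllocation_of_forall`.

Bag filling produces such sets T. Single items go to agents who value them above half of an even
share of what is free, until nobody does (`SingleInv`, `Stable`). Then prefixes of the free items
are handed out by the same criterion. A prefix is accepted as soon as one more item makes it
attractive, and that item is small, so the agents who stay keep their even share (`BagInv.offer`).
This loses one factor of two.

The machine can add and double but neither multiply nor divide, so the rational values are first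
scaled by a common power of two and rounded down to powers of two. This loses the other factor of
two. -/

/-! ### Averaging over permutations. -/

/-- Some permutation does at least as well as a given doubly stochastic matrix. -/
theorem exists_perm_sum_le_of_mem_doublyStochastic {ι : Type*} [Fintype ι] [DecidableEq ι]
    {M : Matrix ι ι ℚ} (hM : M ∈ doublyStochastic ℚ ι) (V w : ι → ℚ) :
    ∃ σ : Equiv.Perm ι, ∑ k, V k * w (σ k) ≤ ∑ k, V k * ∑ j, M k j * w j := by
  obtain ⟨c, hc0, hc1, rfl⟩ := exists_eq_sum_perm_of_mem_doublyStochastic hM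
  have key : ∑ k, V k * ∑ j, (∑ σ : Equiv.Perm ι, c σ • σ.permMatrix ℚ) k j * w j
      = ∑ σ : Equiv.Perm ι, c σ * ∑ k, V k * w (σ k) := by
    simp only [Matrix.sum_apply, Matrix.smul_apply, PEquiv.toMatrix_apply, Equiv.toPEquiv_apply,
      Option.mem_def, Option.some.injEq, smul_eq_mul, Finset.sum_mul, Finset.mul_sum]
    rw [Finset.sum_congr rfl fun k _ => Finset.sum_comm, Finset.sum_comm]
    refine Finset.sum_congr rfl fun σ _ => Finset.sum_congr rfl fun k _ => ?_
    rw [Finset.sum_eq_single (σ k)]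
    · simp; ring
    · intro j _ hj
      simp [Ne.symm hj]
    · simp
  -- The right-hand side is a convex combination of the values of the permutations, so they cannot
  -- all exceed it.
  by_contra! h
  rw [key] at h
  have h1 : ∀ σ ∈ Finset.univ, c σ * ∑ τ : Equiv.Perm ι, c τ * ∑ k, V k * w (τ k)
      ≤ c σ * ∑ k, V k * w (σ k) := fun σ _ => mul_le_mul_of_nonneg_left (h σ).le (hc0 σ)
  obtain ⟨σ, hσ⟩ : ∃ σ, 0 < c σ := by
    by_contra! h0
    linarith [Finset.sum_nonpos fun σ (_ : σ ∈ Finset.univ) => h0 σ]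
  have h2 := Finset.sum_lt_sum h1 ⟨σ, Finset.mem_univ _, mul_lt_mul_of_pos_left (h σ) hσ⟩
  rw [← Finset.sum_mul, hc1, one_mul] at h2
  exact lt_irrefl _ h2

/-- The matrix that sends the rows in `K` along `g` and spreads the other rows evenly over the
columns that are left. -/
def extendUniformly {ι : Type*} [Fintype ι] [DecidableEq ι] (K : Finset ι) (g : ι → ι) :
    Matrix ι ι ℚ :=
  Matrix.of fun k j => if k ∈ K then (if j = g k then 1 else 0)
    else if j ∈ K.image g then 0 else 1 / ((Fintype.card ι : ℚ) - K.card)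

theorem extendUniformly_mem_doublyStochastic {ι : Type*} [Fintype ι] [DecidableEq ι]
    (K : Finset ι) (hK : K.card < Fintype.card ι) (g : ι → ι) (hg : Set.InjOn g K) :
    extendUniformly K g ∈ doublyStochastic ℚ ι := by
  have hpos : (0 : ℚ) < (Fintype.card ι : ℚ) - K.card := by
    rw [sub_pos]; exact_mod_cast hK
  have hcard : (K.image g).card = K.card := Finset.card_image_of_injOn hg
  -- Used for rows with S = `K.image g` and for columns with S = `K`; the two sets are equally large
  -- because `g` is injective on `K`.
  have hcompl : ∀ S : Finset ι, S.card = K.card →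
      ∑ j, (if j ∈ S then 0 else 1 / ((Fintype.card ι : ℚ) - K.card)) = 1 := by
    intro S hS
    rw [Finset.sum_ite]
    have : (Finset.univ.filter fun j => j ∉ S) = Sᶜ := by ext; simp
    rw [this]
    simp only [Finset.sum_const_zero, Finset.sum_const, Finset.card_compl, hS, nsmul_eq_mul,
      zero_add]
    rw [Nat.cast_sub hK.le]
    field_simp
  rw [mem_doublyStochastic_iff_sum]
  refine ⟨fun k j => ?_, fun k => ?_, fun j => ?_⟩
  · simp only [extendUniformly, Matrix.of_apply]
    split_ifs
    exacts [zero_le_one, le_rfl, le_rfl, (one_div_pos.2 hpos).le]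
  · simp only [extendUniformly, Matrix.of_apply]
    by_cases hk : k ∈ K
    · simp [hk]
    · simp only [hk, if_false]
      exact hcompl _ hcard
  · simp only [extendUniformly, Matrix.of_apply]
    by_cases hj : j ∈ K.image g
    · obtain ⟨k, hk, rfl⟩ := Finset.mem_image.1 hj
      rw [Finset.sum_eq_single k]
      · simp [hk]
      · intro k' _ hne
        by_cases hk' : k' ∈ K
        · simp only [hk', if_true]
          rw [if_neg]
          exact fun h => hne (hg hk' hk h.symm)
        · simp only [hk', if_false, hj, if_true]
      · simp
    · refine (Finset.sum_congr rfl fun k _ => ?_).trans (hcompl K rfl)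
      by_cases hk : k ∈ K
      · have : j ≠ g k := fun h => hj (h ▸ Finset.mem_image_of_mem g hk)
        simp [hk, this]
      · simp only [hk, if_false, hj]

/-! ### Upper bounds on the extended-maximin-share. -/

namespace NetworkExternalities.AllocInstance

variable (I : AllocInstance)

theorem utility_eq_sum (i : Fin I.n) (P : I.Partition) (σ : Equiv.Perm (Fin I.n)) :
    I.utility i P σ = ∑ b, I.value i b * I.weight (σ (P b)) i := by
  unfold utility setValue Partition.bundle
  rw [← Finset.sum_fiberwise_of_maps_to (s := Finset.univ) (t := Finset.univ) (g := P) (by simp)]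
  refine Finset.sum_congr rfl fun k _ => ?_
  rw [Finset.sum_mul]
  refine Finset.sum_congr rfl fun b hb => ?_
  rw [(Finset.mem_filter.1 hb).2]

/-- If fewer than `n` items are handed out to distinct agents, the worst utility of a partition is
at most what these items contribute plus an even share of the rest. -/
theorem worstUtility_le (i : Fin I.n) (P : I.Partition) (T : Finset (Fin I.m))
    (al : Fin I.m → Fin I.n) (hal : Set.InjOn al T) (hT : T.card < I.n) :
    I.worstUtility i P ≤ ∑ t ∈ T, I.value i t * I.weight (al t) i
      + (∑ b ∈ Tᶜ, I.value i b) * (1 / ((I.n : ℚ) - T.card)) := by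
  set r : ℚ := 1 / ((I.n : ℚ) - T.card) with hr
  -- Only items whose owner has weight at most the even share `r` need routing; for the others the
  -- bound `r` is already good enough.
  set T' := T.filter fun t => I.weight (al t) i ≤ r with hT'
  set K := T'.image P with hK
  have hKT : K.card ≤ T.card := Finset.card_image_le.trans (Finset.card_filter_le _ _)
  have hmin : ∀ k, ∃ j, k ∈ K → ∃ t ∈ T', P t = k ∧ al t = j ∧
      ∀ t' ∈ T', P t' = k → I.weight j i ≤ I.weight (al t') i := by
    intro k
    by_cases hk : k ∈ K
    · have hne : (T'.filter fun t => P t = k).Nonempty := by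
        obtain ⟨t, ht, htk⟩ := Finset.mem_image.1 hk
        exact ⟨t, Finset.mem_filter.2 ⟨ht, htk⟩⟩
      obtain ⟨t, ht, hle⟩ := Finset.exists_min_image _ (fun t => I.weight (al t) i) hne
      rw [Finset.mem_filter] at ht
      exact ⟨al t, fun _ => ⟨t, ht.1, ht.2, rfl,
        fun t' h1 h2 => hle t' (Finset.mem_filter.2 ⟨h1, h2⟩)⟩⟩
    · exact ⟨k, fun h => absurd h hk⟩
  choose g hg using hmin
  -- Different bundles are routed by different items, and these have different owners.
  have hginj : Set.InjOn g K := by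
    intro k hk k' hk' h
    obtain ⟨t, ht, rfl, h1, -⟩ := hg k hk
    obtain ⟨t', ht', rfl, h2, -⟩ := hg k' hk'
    rw [hal (Finset.mem_filter.1 ht).1 (Finset.mem_filter.1 ht').1 (h1.trans (h.trans h2.symm))]
  have hKn : K.card < Fintype.card (Fin I.n) := by simpa using hKT.trans_lt hT
  have hM := extendUniformly_mem_doublyStochastic K hKn g hginj
  obtain ⟨σ, hσ⟩ := exists_perm_sum_le_of_mem_doublyStochastic hM
    (fun k => I.setValue i (P.bundle k)) (fun j => I.weight j i)
  refine (Finset.inf'_le _ (Finset.mem_univ σ)).trans (hσ.trans ?_)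
  set M := extendUniformly K g with hMdef
  set c : Fin I.n → ℚ := fun k => ∑ j, M k j * I.weight j i with hc
  have hTn : (0 : ℚ) < (I.n : ℚ) - T.card := by rw [sub_pos]; exact_mod_cast hT
  have hcK : ∀ k ∈ K, c k = I.weight (g k) i := by
    intro k hk
    simp [hc, hMdef, extendUniformly, hk]
  have hcr : ∀ k, c k ≤ r := by
    intro k
    by_cases hk : k ∈ K
    · rw [hcK k hk]
      obtain ⟨t, ht, -, h1, -⟩ := hg k hk
      rw [← h1]
      exact (Finset.mem_filter.1 ht).2
    -- An evenly spread row has entries at most `r`, since `K` is no larger than `T`, and the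
    -- weights on `i` sum to one.
    · have h1 : c k ≤ ∑ j, r * I.weight j i := by
        refine Finset.sum_le_sum fun j _ =>
          mul_le_mul_of_nonneg_right ?_ (I.weight_nonneg j i)
        simp only [hMdef, extendUniformly, Matrix.of_apply, hk, if_false, Fintype.card_fin]
        split_ifs
        · exact (one_div_pos.2 hTn).le
        · refine one_div_le_one_div_of_le hTn ?_
          have : (K.card : ℚ) ≤ T.card := by exact_mod_cast hKT
          linarith
      rwa [← Finset.mul_sum, I.weight_sum, mul_one] at h1
  have hsum : ∑ k, I.setValue i (P.bundle k) * c k = ∑ b, I.value i b * c (P b) := by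
    unfold setValue Partition.bundle
    rw [← Finset.sum_fiberwise_of_maps_to (s := Finset.univ) (t := Finset.univ) (g := P)
      (by simp)]
    refine Finset.sum_congr rfl fun k _ => ?_
    rw [Finset.sum_mul]
    refine Finset.sum_congr rfl fun b hb => ?_
    rw [(Finset.mem_filter.1 hb).2]
  rw [hsum, ← Finset.sum_add_sum_compl T, Finset.sum_mul]
  refine add_le_add (Finset.sum_le_sum fun t ht => ?_) (Finset.sum_le_sum fun b _ => ?_)
  · refine mul_le_mul_of_nonneg_left ?_ (I.value_nonneg i t)
    by_cases h : I.weight (al t) i ≤ r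
    · have ht' : t ∈ T' := Finset.mem_filter.2 ⟨ht, h⟩
      have hk : P t ∈ K := Finset.mem_image_of_mem P ht'
      rw [hcK _ hk]
      obtain ⟨-, -, -, -, h4⟩ := hg _ hk
      exact h4 t ht' rfl
    · exact (hcr _).trans (not_le.1 h).le
  · exact mul_le_mul_of_nonneg_left (hcr _) (I.value_nonneg i b)

/-- An allocation in which every agent values the items outside a set of fewer than `n` items, held
by distinct other agents, at most `4 (n - h)` times his own bundle is an
`α/4`-`EMMS` allocation. -/
theorem isEMMSAllocation_of_forall (α : ℝ) (A : Fin I.m → Fin I.n) (hα : ∀ i, I.SelfReliant α i)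
    (h : ∀ i, ∃ T : Finset (Fin I.m), Set.InjOn A T ∧ (∀ t ∈ T, A t ≠ i) ∧ T.card < I.n ∧
      ∑ b ∈ Tᶜ, I.value i b ≤
        4 * ((I.n : ℚ) - T.card) * ∑ b with A b = i, I.value i b) :
    I.IsEMMSAllocation (α / 4) A := by
  intro i
  obtain ⟨T, hinj, hne, hT, hle⟩ := h i
  have hTn : (0 : ℚ) < (I.n : ℚ) - T.card := by rw [sub_pos]; exact_mod_cast hT
  set x := ∑ b with A b = i, I.value i b with hx
  set S := ∑ t ∈ T, I.value i t * I.weight (A t) i with hS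
  have hS0 : 0 ≤ S := Finset.sum_nonneg fun t _ => mul_nonneg (I.value_nonneg _ _)
    (I.weight_nonneg _ _)
  have hE : I.EMMS i ≤ S + 4 * x := by
    refine Finset.sup'_le _ _ fun P _ => (I.worstUtility_le i P T A hinj hT).trans ?_
    refine add_le_add le_rfl ?_
    rw [mul_one_div, div_le_iff₀ hTn]
    linarith
  have hE0 : 0 ≤ I.EMMS i := by
    refine le_trans ?_ (Finset.le_sup' _ (Finset.mem_univ A))
    refine Finset.le_inf' _ _ fun σ _ => ?_
    rw [utility_eq_sum]
    exact Finset.sum_nonneg fun b _ => mul_nonneg (I.value_nonneg _ _) (I.weight_nonneg _ _)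
  have hU : S + x * I.weight i i ≤ I.utility i A (Equiv.refl _) := by
    rw [utility_eq_sum]
    have hd : Disjoint T (Finset.univ.filter fun b => A b = i) := by
      rw [Finset.disjoint_left]
      intro t ht h'
      exact hne t ht (Finset.mem_filter.1 h').2
    have h1 : x * I.weight i i
        = ∑ b with A b = i, I.value i b * I.weight ((Equiv.refl _) (A b)) i := by
      rw [hx, Finset.sum_mul]
      refine Finset.sum_congr rfl fun b hb => ?_
      rw [Equiv.refl_apply, (Finset.mem_filter.1 hb).2]
    rw [h1, hS]
    refine (Finset.sum_union hd).symm.le.trans ?_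
    exact Finset.sum_le_univ_sum_of_nonneg fun b =>
      mul_nonneg (I.value_nonneg _ _) (I.weight_nonneg _ _)
  have hw0 := I.weight_nonneg i i
  have hw1 : I.weight i i ≤ 1 := by
    rw [← I.weight_sum i]
    exact Finset.single_le_sum (f := fun j => I.weight j i) (fun j _ => I.weight_nonneg j i)
      (Finset.mem_univ i)
  have hfin : I.weight i i / 4 * I.EMMS i ≤ I.utility i A (Equiv.refl _) := by
    have := mul_le_mul_of_nonneg_left hE (div_nonneg hw0 (by norm_num : (0 : ℚ) ≤ 4))
    have h2 : I.weight i i * S ≤ S := mul_le_of_le_one_left hS0 hw1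
    linarith
  have hfin' : (I.weight i i : ℝ) / 4 * I.EMMS i ≤ (I.utility i A (Equiv.refl _) : ℝ) := by
    exact_mod_cast hfin
  refine le_trans (mul_le_mul_of_nonneg_right ?_ (by exact_mod_cast hE0)) hfin'
  have := hα i
  unfold SelfReliant at this
  linarith

end NetworkExternalities.AllocInstance

/-! ## Bag filling -/

namespace BagFilling

/-- A state of the bag filling algorithm. -/
structure Config (n m : ℕ) where
  /-- the items that are not handed out -/
  free : Finset (Fin m)
  /-- the agents who have no bundle -/
  active : Finset (Fin n)
  /-- the owners of the items that are handed out -/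
  owner : Fin m → Fin n

variable {n m : ℕ} (v : Fin n → Fin m → ℕ)

/-- The free items in a range of positions. -/
def Config.bag (c : Config n m) (lo hi : ℕ) : Finset (Fin m) :=
  c.free.filter fun b => lo ≤ b ∧ (b : ℕ) < hi

/-- Agent `i` gets the bundle `B` and leaves. -/
def Config.give (c : Config n m) (i : Fin n) (B : Finset (Fin m)) : Config n m where
  free := c.free \ B
  active := c.active.erase i
  owner b := if b ∈ B then i else c.owner b

/-- Agent `i` would take the free items in a range: they are worth to him more than half of an even
share of the free items. -/
def Config.Accepts (c : Config n m) (i : Fin n) (lo hi : ℕ) : Prop :=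
  i ∈ c.active ∧ ∑ b ∈ c.free, v i b < 2 * (c.active.card * ∑ b ∈ c.bag lo hi, v i b)

open Classical in
/-- Offer the free items in a range to agent `i`. -/
noncomputable def Config.offer (i : Fin n) (lo hi : ℕ) (c : Config n m) : Config n m :=
  if c.Accepts v i lo hi then c.give i (c.bag lo hi) else c

/-- Apart from some items held by distinct other agents, the items are worth to agent `i` at most
twice the value of his bundle for every agent without such an item. -/
def Config.Satisfied (c : Config n m) (i : Fin n) : Prop :=
  ∃ T ⊆ c.freeᶜ, Set.InjOn c.owner T ∧ (∀ t ∈ T, c.owner t ≠ i) ∧ ∃ k, 0 < k ∧ T.card + k = n ∧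
    ∑ b ∈ Tᶜ, v i b ≤ 2 * (k * ∑ b ∈ c.freeᶜ with c.owner b = i, v i b)

theorem Config.bag_subset (c : Config n m) (lo hi : ℕ) : c.bag lo hi ⊆ c.free :=
  Finset.filter_subset _ _

variable {v}

/-- Later gifts consist of free items, so they change no owner of an item of `T` and take nothing
from the bundle of `i`. This is why satisfaction counts only items already handed out. -/
theorem Config.Satisfied.give {c : Config n m} {i : Fin n} (h : c.Satisfied v i) (j : Fin n)
    {B : Finset (Fin m)} (hB : B ⊆ c.free) : (c.give j B).Satisfied v i := by
  obtain ⟨T, hT, hinj, hne, k, hk, hkn, hle⟩ := h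
  have hout : ∀ b ∈ c.freeᶜ, (c.give j B).owner b = c.owner b := fun b hb => by
    have : b ∉ B := fun h => (Finset.mem_compl.1 hb) (hB h)
    simp [Config.give, this]
  have hsub : c.freeᶜ ⊆ (c.give j B).freeᶜ := by
    simp [Config.give]
  refine ⟨T, hT.trans hsub, ?_, ?_, k, hk, hkn, hle.trans ?_⟩
  · intro t ht t' ht' h
    rw [hout t (hT ht), hout t' (hT ht')] at h
    exact hinj ht ht' h
  · intro t ht
    rw [hout t (hT ht)]
    exact hne t ht
  · gcongr
    intro b hb
    rw [Finset.mem_filter] at hb ⊢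
    exact ⟨hsub hb.1, (hout b hb.1).trans hb.2⟩

/-- The agent who leaves takes as witness a set of items that were out before his own bundle; both
phases use it. -/
theorem Config.satisfied_give_self {c : Config n m} {i : Fin n} {B T : Finset (Fin m)} {k : ℕ}
    (hB : B ⊆ c.free) (hT : T ⊆ c.freeᶜ) (hinj : Set.InjOn c.owner T)
    (hne : ∀ t ∈ T, c.owner t ≠ i) (hk : 0 < k) (hkn : T.card + k = n)
    (hle : ∑ b ∈ Tᶜ, v i b ≤ 2 * (k * ∑ b ∈ B, v i b)) : (c.give i B).Satisfied v i := by
  have hout : ∀ b ∈ c.freeᶜ, (c.give i B).owner b = c.owner b := fun b hb => by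
    have : b ∉ B := fun h => (Finset.mem_compl.1 hb) (hB h)
    simp [Config.give, this]
  refine ⟨T, hT.trans (by simp [Config.give]), ?_, ?_, k, hk, hkn, hle.trans ?_⟩
  · intro t ht t' ht' h
    rw [hout t (hT ht), hout t' (hT ht')] at h
    exact hinj ht ht' h
  · intro t ht
    rw [hout t (hT ht)]
    exact hne t ht
  · gcongr
    intro b hb
    simp [Config.give, hb]

theorem Config.offer_of_accepts {c : Config n m} {i : Fin n} {lo hi : ℕ}
    (h : c.Accepts v i lo hi) : c.offer v i lo hi = c.give i (c.bag lo hi) := if_pos h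

theorem Config.offer_of_not_accepts {c : Config n m} {i : Fin n} {lo hi : ℕ}
    (h : ¬ c.Accepts v i lo hi) : c.offer v i lo hi = c := if_neg h

theorem Config.bag_succ (c : Config n m) (b : Fin m) (lo : ℕ) (hb : lo ≤ b) :
    c.bag lo (b + 1) = c.bag lo b ∪ c.bag b (b + 1) := by
  ext x
  simp only [Config.bag, Finset.mem_filter, Finset.mem_union]
  by_cases hx : x ∈ c.free <;> simp only [hx, true_and, false_and, or_false]
  omega

theorem Config.bag_single (c : Config n m) (b : Fin m) :
    c.bag b (b + 1) = if b ∈ c.free then {b} else ∅ := by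
  ext x
  have : ((b : ℕ) ≤ x ∧ (x : ℕ) < b + 1) ↔ x = b := by
    rw [Fin.ext_iff]; omega
  simp only [Config.bag, Finset.mem_filter, this]
  split_ifs with h
  · simp only [Finset.mem_singleton, and_iff_right_iff_imp]
    rintro rfl
    exact h
  · simp only [Finset.notMem_empty, iff_false, not_and]
    rintro hx rfl
    exact h hx

/-! ### First phase: single items. -/

variable (v)

/-- The invariant of the phase in which single items are handed out. -/
structure SingleInv (c : Config n m) : Prop where
  inj : Set.InjOn c.owner (c.freeᶜ : Finset (Fin m))
  owner_notMem : ∀ b ∉ c.free, c.owner b ∉ c.active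
  card : c.freeᶜ.card + c.active.card = n
  sat : ∀ i ∉ c.active, c.Satisfied v i

/-- No active agent accepts any single item. -/
def Stable (c : Config n m) : Prop :=
  ∀ (i : Fin n) (b : Fin m), ¬ c.Accepts v i b (b + 1)

/-- The state of affairs in pass `r` over the items, when item `b` is offered to agent `i`. -/
def SingleProgress (r b i : ℕ) (c : Config n m) : Prop :=
  SingleInv v c ∧ (c.active.card + r + 1 ≤ n ∨ ((c.active.card + r ≤ n ∨ Stable v c) ∧
    ∀ (i' : Fin n) (b' : Fin m), ((b' : ℕ) < b ∨ (b' : ℕ) = b ∧ (i' : ℕ) < i) →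
      ¬ c.Accepts v i' b' (b' + 1)))

variable {v}

/-- Each gift removes one item and one agent, which keeps the two counts adding up to `n`. The
leaving agent is satisfied with `T` the items already out: `k` is then the number of active agents,
and the inequality is his acceptance. -/
theorem SingleInv.offer {c : Config n m} (h : SingleInv v c) (i : Fin n) (b : Fin m) :
    SingleInv v (c.offer v i b (b + 1)) := by
  by_cases ha : c.Accepts v i b (b + 1)
  swap
  · rwa [Config.offer_of_not_accepts ha]
  rw [Config.offer_of_accepts ha]
  have hb : b ∈ c.free := by
    by_contra hb
    have := ha.2
    simp [Config.bag_single, hb] at this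
  have hbag : c.bag b (b + 1) = {b} := by simp [Config.bag_single, hb]
  have hcompl : (c.free \ {b})ᶜ = insert b c.freeᶜ := by
    ext x
    simp only [Finset.mem_compl, Finset.mem_sdiff, Finset.mem_singleton, Finset.mem_insert]
    tauto
  have hne : ∀ t ∈ c.freeᶜ, c.owner t ≠ i := fun t ht h' =>
    h.owner_notMem t (Finset.mem_compl.1 ht) (h' ▸ ha.1)
  have howner : ∀ t ∈ c.freeᶜ, (c.give i {b}).owner t = c.owner t := by
    intro t ht
    have : t ≠ b := by rintro rfl; exact Finset.mem_compl.1 ht hb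
    simp [Config.give, this]
  have howner_b : (c.give i {b}).owner b = i := by simp [Config.give]
  rw [hbag]
  refine ⟨?_, ?_, ?_, ?_⟩
  · have : (c.give i {b}).freeᶜ = insert b c.freeᶜ := hcompl
    rw [this, Finset.coe_insert, Set.injOn_insert (by simpa using hb)]
    refine ⟨fun t ht t' ht' h' => ?_, ?_⟩
    · rw [howner t (by simpa using ht), howner t' (by simpa using ht')] at h'
      exact h.inj ht ht' h'
    · rintro ⟨t, ht, h'⟩
      have ht' : t ∈ c.freeᶜ := by simpa using ht
      rw [howner t ht', howner_b] at h'
      exact hne t ht' h'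
  · intro t ht
    have ht' : t ∈ insert b c.freeᶜ := hcompl ▸ Finset.mem_compl.2 ht
    rcases Finset.mem_insert.1 ht' with rfl | ht'
    · rw [howner_b]
      simp [Config.give]
    · rw [howner t ht']
      exact fun h' => h.owner_notMem t (Finset.mem_compl.1 ht') (Finset.mem_of_mem_erase h')
  · have : (c.give i {b}).freeᶜ = insert b c.freeᶜ := hcompl
    rw [this, Finset.card_insert_of_notMem (by simpa using hb)]
    have h1 := Finset.card_erase_add_one ha.1
    have h2 := h.card
    change _ + (c.active.erase i).card = n
    omega
  · intro j hj
    by_cases hji : j = i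
    · subst hji
      refine Config.satisfied_give_self (by simpa using hb) subset_rfl h.inj hne
        (Finset.card_pos.2 ⟨j, ha.1⟩) h.card ?_
      have := ha.2
      rw [hbag] at this
      rw [compl_compl]
      exact this.le
    · refine (h.sat j fun h' => hj ?_).give i (by simpa using hb)
      exact Finset.mem_erase.2 ⟨hji, h'⟩

theorem Config.card_active_offer_le (c : Config n m) (i : Fin n) (lo hi : ℕ) :
    (c.offer v i lo hi).active.card ≤ c.active.card := by
  by_cases ha : c.Accepts v i lo hi
  · rw [Config.offer_of_accepts ha]
    exact Finset.card_erase_le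
  · rw [Config.offer_of_not_accepts ha]

/-- The first acceptance in a pass secures the agent that this pass has to remove. Until then the
configuration does not change, so earlier refusals remain valid. -/
theorem SingleProgress.offer {r : ℕ} {b : Fin m} {i : Fin n} {c : Config n m}
    (h : SingleProgress v r b i c) : SingleProgress v r b (i + 1) (c.offer v i b (b + 1)) := by
  refine ⟨h.1.offer i b, ?_⟩
  rcases h.2 with h1 | ⟨h1, h2⟩
  · left
    have := c.card_active_offer_le (v := v) i b (b + 1)
    omega
  · by_cases ha : c.Accepts v i b (b + 1)
    · left
      rcases h1 with h1 | h1
      · rw [Config.offer_of_accepts ha]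
        have := Finset.card_erase_add_one ha.1
        change (c.active.erase i).card + r + 1 ≤ n
        omega
      · exact absurd ha (h1 i b)
    · right
      rw [Config.offer_of_not_accepts ha]
      refine ⟨h1, fun i' b' h' => ?_⟩
      by_cases he : (b' : ℕ) = b ∧ (i' : ℕ) = i
      · obtain rfl := Fin.ext he.1
        obtain rfl := Fin.ext he.2
        exact ha
      · exact h2 i' b' (by omega)

theorem SingleProgress.next_item {r b : ℕ} {c : Config n m} (h : SingleProgress v r b n c) :
    SingleProgress v r (b + 1) 0 c :=
  ⟨h.1, h.2.imp_right fun h' => ⟨h'.1, fun i' b' hb => h'.2 i' b' (by omega)⟩⟩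

theorem SingleProgress.next_pass {r : ℕ} {c : Config n m} (h : SingleProgress v r m 0 c) :
    SingleProgress v (r + 1) 0 0 c := by
  refine ⟨h.1, Or.inr ⟨?_, fun _ _ h' => by omega⟩⟩
  rcases h.2 with h' | h'
  · left; omega
  · right
    exact fun i b => h'.2 i b (Or.inl b.2)

/-- Each pass removes an agent or certifies stability, so after `n` passes either nobody is active
or nobody accepts. -/
theorem SingleProgress.stable {c : Config n m} (h : SingleProgress v n 0 0 c) : Stable v c := by
  rcases h.2 with h' | ⟨h' | h', -⟩
  · omega
  · intro i b ha
    have := Finset.card_pos.2 ⟨i, ha.1⟩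
    omega
  · exact h'

/-- The configuration in which nothing is handed out. -/
def Config.start (a : Fin n) : Config n m := ⟨Finset.univ, Finset.univ, fun _ => a⟩

theorem singleProgress_start (a : Fin n) :
    SingleProgress v 0 0 0 (Config.start a : Config n m) := by
  refine ⟨⟨?_, ?_, ?_, ?_⟩, Or.inr ⟨Or.inl ?_, fun _ _ h => by omega⟩⟩ <;> simp [Config.start]

/-! ### Second phase: prefixes of the free items. -/

variable (v)

/-- The invariant of the phase in which larger bundles are handed out, when the free items up to
`b` are offered to agent `i`; the phase started in the configuration `c₀`. -/
structure BagInv (c₀ : Config n m) (b i : ℕ) (c : Config n m) : Prop where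
  free_subset : c.free ⊆ c₀.free
  active_subset : c.active ⊆ c₀.active
  owner_eq : ∀ t ∉ c₀.free, c.owner t = c₀.owner t
  share : ∀ j ∈ c.active,
    c.active.card * ∑ t ∈ c₀.free, v j t ≤ c₀.active.card * ∑ t ∈ c.free, v j t
  sat : ∀ j ∉ c.active, c.Satisfied v j
  below : ∀ j, ¬ c.Accepts v j 0 b
  current : ∀ j : Fin n, (j : ℕ) < i → ¬ c.Accepts v j 0 (b + 1)

variable {v}

theorem bagInv_start {c : Config n m} (h : SingleInv v c) : BagInv v c 0 0 c where
  free_subset := subset_rfl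
  active_subset := subset_rfl
  owner_eq _ _ := rfl
  share _ _ := le_rfl
  sat := h.sat
  below j ha := by simpa [Config.bag] using ha.2
  current j hj := by omega

theorem BagInv.next_item {c₀ c : Config n m} {b : ℕ} (h : BagInv v c₀ b n c) :
    BagInv v c₀ (b + 1) 0 c :=
  { h with
    below := fun j => h.current j j.2
    current := fun j hj => by omega }

/-- The refused prefix is worth B ≤ F/(2(k+1)), and the extra item x ≤ F₀/(2N) ≤ F/(2(k+1)).
Together they cost at most one even share of F, so the share of the k remaining agents does not drop
below F₀/N. -/
theorem mul_le_mul_sub_of_share {k N F F₀ B x : ℕ} (hk : 0 < k) (hshare : (k + 1) * F₀ ≤ N * F)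
    (hprev : 2 * ((k + 1) * B) ≤ F) (hx : 2 * (N * x) ≤ F₀) (hle : B + x ≤ F) :
    k * F₀ ≤ N * (F - (B + x)) := by
  zify [hle]
  zify at hshare hprev hx hle hk
  have h1 : ((k : ℤ) + 1) * (2 * (N * x)) ≤ (k + 1) * F₀ :=
    mul_le_mul_of_nonneg_left hx (by positivity)
  have h2 : (N : ℤ) * (2 * ((k + 1) * B)) ≤ N * F :=
    mul_le_mul_of_nonneg_left hprev (by positivity)
  have h3 : (k : ℤ) * ((k + 1) * F₀) ≤ k * (N * F) :=
    mul_le_mul_of_nonneg_left hshare (by positivity)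
  have h4 : ((k : ℤ) + 1) * (k * F₀) ≤ (k + 1) * (N * (F - (B + x))) := by nlinarith
  exact le_of_mul_le_mul_left h4 (by positivity)

/-- For an agent who stays, the prefix without item `b` was refused and item `b` alone is small by
stability, so `mul_le_mul_sub_of_share` applies. For the agent who leaves, the share inequality
turns half of the current even share into half of the one at the start of the phase, with `T` the
items of the first phase. -/
theorem BagInv.offer {c₀ c : Config n m} {b : Fin m} {i : Fin n} (h₀ : SingleInv v c₀)
    (hst : Stable v c₀) (h : BagInv v c₀ b i c) :
    BagInv v c₀ b (i + 1) (c.offer v i 0 (b + 1)) := by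
  by_cases ha : c.Accepts v i 0 (b + 1)
  swap
  · rw [Config.offer_of_not_accepts ha]
    refine { h with current := fun j hj => ?_ }
    by_cases hji : (j : ℕ) = i
    · obtain rfl := Fin.ext hji
      exact ha
    · exact h.current j (by omega)
  rw [Config.offer_of_accepts ha]
  set B := c.bag 0 (b + 1) with hB
  have hBF : B ⊆ c.free := c.bag_subset _ _
  -- The bag is everything free up to item `b`, so nothing is left there, and an empty bag is never
  -- accepted.
  have hempty : ∀ hi : ℕ, hi ≤ b + 1 → (c.give i B).bag 0 hi = ∅ := by
    intro hi hhi
    ext x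
    simp only [Config.bag, Config.give, hB, Finset.mem_filter, Finset.mem_sdiff,
      Finset.notMem_empty, iff_false]
    rintro ⟨⟨h1, h2⟩, h3⟩
    exact h2 ⟨h1, by omega⟩
  have hrej : ∀ (j : Fin n) (hi : ℕ), hi ≤ b + 1 → ¬ (c.give i B).Accepts v j 0 hi := by
    intro j hi hhi ha'
    have := ha'.2
    rw [hempty hi hhi] at this
    simp at this
  have hcard := Finset.card_erase_add_one ha.1
  have hT : c₀.freeᶜ ⊆ c.freeᶜ := by simpa using h.free_subset
  refine ⟨Finset.sdiff_subset.trans h.free_subset,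
    (Finset.erase_subset _ _).trans h.active_subset, fun t ht => ?_, fun j hj => ?_,
    fun j hj => ?_, fun j => hrej j b (by omega), fun j _ => hrej j (b + 1) le_rfl⟩
  · have : t ∉ B := fun h' => ht (h.free_subset (hBF h'))
    simp only [Config.give, this, if_false]
    exact h.owner_eq t ht
  · have hjc : j ∈ c.active := Finset.mem_of_mem_erase hj
    have hpos : 0 < (c.active.erase i).card := Finset.card_pos.2 ⟨j, hj⟩
    have hBsum : ∑ t ∈ B, v j t
        = ∑ t ∈ c.bag 0 b, v j t + ∑ t ∈ c.bag b (b + 1), v j t := by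
      rw [hB, c.bag_succ b 0 (Nat.zero_le _), Finset.sum_union]
      rw [Finset.disjoint_left]
      intro t ht ht'
      simp only [Config.bag, Finset.mem_filter] at ht ht'
      omega
    have hle : ∑ t ∈ B, v j t ≤ ∑ t ∈ c.free, v j t :=
      Finset.sum_le_sum_of_subset hBF
    have hfree : ∑ t ∈ (c.give i B).free, v j t
        = ∑ t ∈ c.free, v j t - ∑ t ∈ B, v j t := by
      have := Finset.sum_sdiff (f := v j) hBF
      change ∑ t ∈ c.free \ B, v j t = _
      omega
    have hprev : ¬ _ := h.below j
    have hsingle := hst j b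
    simp only [Config.Accepts, hjc, h.active_subset hjc, true_and, not_lt] at hprev hsingle
    have hmono : ∑ t ∈ c.bag b (b + 1), v j t ≤ ∑ t ∈ c₀.bag b (b + 1), v j t :=
      Finset.sum_le_sum_of_subset (Finset.filter_subset_filter _ h.free_subset)
    have hsh := h.share j hjc
    rw [← hcard] at hprev hsh
    rw [hfree, hBsum]
    rw [hBsum] at hle
    refine mul_le_mul_sub_of_share hpos hsh hprev (le_trans ?_ hsingle) hle
    gcongr
  · by_cases hji : j = i
    · subst hji
      have hpos : 0 < c.active.card := Finset.card_pos.2 ⟨j, ha.1⟩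
      have howner : ∀ t ∈ c₀.freeᶜ, c.owner t = c₀.owner t := fun t ht =>
        h.owner_eq t (Finset.mem_compl.1 ht)
      refine Config.satisfied_give_self hBF hT ?_ ?_
        (Finset.card_pos.2 ⟨j, h.active_subset ha.1⟩) h₀.card ?_
      · intro t ht t' ht' h'
        rw [howner t ht, howner t' ht'] at h'
        exact h₀.inj ht ht' h'
      · intro t ht h'
        rw [howner t ht] at h'
        exact h₀.owner_notMem t (Finset.mem_compl.1 ht) (h' ▸ h.active_subset ha.1)
      · rw [compl_compl]
        have h1 := h.share j ha.1
        have h2 := Nat.mul_le_mul_left c₀.active.card ha.2.le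
        refine le_of_mul_le_mul_left (h1.trans (h2.trans (le_of_eq ?_))) hpos
        ring
    · refine (h.sat j fun h' => hj ?_).give i hBF
      exact Finset.mem_erase.2 ⟨hji, h'⟩

/-- An agent still active at the end refuses all free items together, which forces their value to be
zero for him. By the share inequality everything free after the first phase was worthless to him. -/
theorem BagInv.satisfied {c₀ c : Config n m} (h₀ : SingleInv v c₀) (h : BagInv v c₀ m 0 c)
    (i : Fin n) : c.Satisfied v i := by
  by_cases hi : i ∈ c.active
  swap
  · exact h.sat i hi
  have hpos : 0 < c.active.card := Finset.card_pos.2 ⟨i, hi⟩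
  have hbag : c.bag 0 m = c.free := by
    ext x; simp [Config.bag]
  have h1 := h.below i
  simp only [Config.Accepts, hi, true_and, not_lt, hbag] at h1
  have h2 : ∑ t ∈ c.free, v i t = 0 := by
    by_contra h3
    have : 1 * ∑ t ∈ c.free, v i t ≤ c.active.card * ∑ t ∈ c.free, v i t :=
      Nat.mul_le_mul_right _ hpos
    omega
  have h3 := h.share i hi
  rw [h2, mul_zero, Nat.le_zero, mul_eq_zero] at h3
  have h4 := h3.resolve_left hpos.ne'
  have howner : ∀ t ∈ c₀.freeᶜ, c.owner t = c₀.owner t := fun t ht =>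
    h.owner_eq t (Finset.mem_compl.1 ht)
  refine ⟨c₀.freeᶜ, by simpa using h.free_subset, ?_, ?_, c₀.active.card,
    Finset.card_pos.2 ⟨i, h.active_subset hi⟩, h₀.card, ?_⟩
  · intro t ht t' ht' h'
    rw [howner t ht, howner t' ht'] at h'
    exact h₀.inj ht ht' h'
  · intro t ht h'
    rw [howner t ht] at h'
    exact h₀.owner_notMem t (Finset.mem_compl.1 ht) (h' ▸ h.active_subset hi)
  · rw [compl_compl, h4]
    exact Nat.zero_le _

end BagFilling

/-! ## Program logic for the random access machine -/

namespace RAM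

@[simp] theorem State.setReg_reg (s : State) (x v y : ℕ) :
    (s.setReg x v).reg y = if y = x then v else s.reg y := by
  simp [State.setReg, Function.update_apply]

@[simp] theorem State.setReg_mem (s : State) (x v : ℕ) : (s.setReg x v).mem = s.mem := rfl

@[simp] theorem State.setMem_reg (s : State) (a k v : ℕ) : (s.setMem a k v).reg = s.reg := rfl

@[simp] theorem State.setMem_mem (s : State) (a k v b j : ℕ) :
    (s.setMem a k v).mem b j = if b = a ∧ j = k then v else s.mem b j := by
  by_cases hb : b = a
  · subst hb
    by_cases hj : j = k <;> simp [State.setMem, hj]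
  · simp [State.setMem, hb]

attribute [simp] Expr.eval Expr.cost

/-- Started in `s`, the program `p` halts after at most `T` steps in a state that satisfies `Q`. -/
def Ends (p : Prog) (s : State) (T : ℕ) (Q : State → Prop) : Prop :=
  ∃ t s', Runs p s t s' ∧ t ≤ T ∧ Q s'

namespace Ends

variable {p q : Prog} {s : State} {T T' : ℕ} {Q R : State → Prop} {e f : Expr} {x y : ℕ}

theorem le (h : Ends p s T Q) (hT : T ≤ T') : Ends p s T' Q := by
  obtain ⟨t, s', h1, h2, h3⟩ := h
  exact ⟨t, s', h1, h2.trans hT, h3⟩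

theorem imp (h : Ends p s T R) (hQ : ∀ s', R s' → Q s') : Ends p s T Q := by
  obtain ⟨t, s', h1, h2, h3⟩ := h
  exact ⟨t, s', h1, h2, hQ _ h3⟩

theorem skip (h : Q s) : Ends .skip s 1 Q := ⟨1, s, .skip s, le_rfl, h⟩

theorem assign (h : Q (s.setReg x (e.eval s))) : Ends (.assign x e) s (e.cost + 1) Q :=
  ⟨_, _, .assign s x e, le_rfl, h⟩

theorem store {a : ℕ} (h : Q (s.setMem a (e.eval s) (f.eval s))) :
    Ends (.store a e f) s (e.cost + f.cost + 1) Q :=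
  ⟨_, _, .store s a e f, le_rfl, h⟩

theorem seq (h : Ends p s T R) (h' : ∀ s', R s' → Ends q s' T' Q) :
    Ends (.seq p q) s (T + T') Q := by
  obtain ⟨t, s', h1, h2, h3⟩ := h
  obtain ⟨t', s'', h1', h2', h3'⟩ := h' s' h3
  exact ⟨_, _, .seq h1 h1', add_le_add h2 h2', h3'⟩

theorem assign_seq (h : Ends q (s.setReg x (e.eval s)) T Q) :
    Ends (.seq (.assign x e) q) s (e.cost + 1 + T) Q :=
  seq (assign (Q := fun s' => s' = s.setReg x (e.eval s)) rfl) fun _ h' => h' ▸ h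

theorem store_seq {a : ℕ} (h : Ends q (s.setMem a (e.eval s) (f.eval s)) T Q) :
    Ends (.seq (.store a e f) q) s (e.cost + f.cost + 1 + T) Q :=
  seq (store (Q := fun s' => s' = s.setMem a (e.eval s) (f.eval s)) rfl) fun _ h' => h' ▸ h

theorem branch (h : e.eval s < f.eval s → Ends p s T Q)
    (h' : ¬ e.eval s < f.eval s → Ends q s T Q) :
    Ends (.branch e f p q) s (e.cost + f.cost + 1 + T) Q := by
  by_cases hc : e.eval s < f.eval s
  · obtain ⟨t, s', h1, h2, h3⟩ := h hc
    exact ⟨_, s', .branch_true hc h1, by gcongr, h3⟩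
  · obtain ⟨t, s', h1, h2, h3⟩ := h' hc
    exact ⟨_, s', .branch_false hc h1, by gcongr, h3⟩

/-- The rule for loops; `Inv k` says that at most `k` iterations remain. -/
theorem loop {Inv : ℕ → State → Prop}
    (hstep : ∀ k s, Inv k s → e.eval s < f.eval s →
      ∃ k', k = k' + 1 ∧ Ends p s T (Inv k')) {k : ℕ} (h : Inv k s) :
    Ends (.loop e f p) s ((k + 1) * (e.cost + f.cost + 1 + T))
      (fun s' => (∃ k', Inv k' s') ∧ ¬ e.eval s' < f.eval s') := by
  induction k generalizing s with
  | zero =>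
    by_cases hc : e.eval s < f.eval s
    · obtain ⟨k', hk', -⟩ := hstep 0 s h hc
      omega
    · exact ⟨_, s, .loop_false hc, by omega, ⟨0, h⟩, hc⟩
  | succ k ih =>
    by_cases hc : e.eval s < f.eval s
    · obtain ⟨k', hk', t, s', h1, h2, h3⟩ := hstep _ s h hc
      obtain rfl : k = k' := by omega
      obtain ⟨t', s'', h1', h2', h3'⟩ := ih h3
      refine ⟨_, s'', .loop_true hc h1 h1', ?_, h3'⟩
      rw [Nat.succ_mul (k + 1)]
      omega
    · refine ⟨_, s, .loop_false hc, ?_, ⟨_, h⟩, hc⟩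
      rw [Nat.succ_mul]
      omega

end Ends

/-- Run `p` with the values `0, 1, …` in register `x`, up to the bound in register `y`. -/
def forLoop (x y : ℕ) (p : Prog) : Prog :=
  .seq (.assign x (.const 0))
    (.loop (.reg x) (.reg y) (.seq p (.assign x (.add (.reg x) (.const 1)))))

/-- `J k` speaks of the state in which the counter is already `k`, so the body must establish it
after the increment. The 7 pays for the test (3) and the increment (4), the 2 for the
initialization. -/
theorem Ends.forLoop {p : Prog} {s : State} {T N x y : ℕ} {J : ℕ → State → Prop} (hxy : x ≠ y)
    (hy : s.reg y = N) (h0 : J 0 (s.setReg x 0))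
    (hstep : ∀ k < N, ∀ s, s.reg x = k → s.reg y = N → J k s →
      Ends p s T fun s' => s'.reg x = k ∧ s'.reg y = N ∧ J (k + 1) (s'.setReg x (k + 1))) :
    Ends (forLoop x y p) s ((N + 1) * (T + 7) + 2) (fun s' => s'.reg y = N ∧ J N s') := by
  have hl := Ends.loop (s := s.setReg x 0) (k := N) (e := .reg x) (f := .reg y)
    (p := .seq p (.assign x (.add (.reg x) (.const 1)))) (T := T + 4)
    (Inv := fun k s => ∃ j, j + k = N ∧ s.reg x = j ∧ s.reg y = N ∧ J j s) ?_
    ⟨0, by omega, by simp, by simp [hxy.symm, hy], h0⟩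
  · refine (Ends.assign_seq (hl.imp (Q := fun s' => s'.reg y = N ∧ J N s') ?_)).le ?_
    · rintro s' ⟨⟨k, j, hj, hx, hy, hJ⟩, hc⟩
      simp only [Expr.eval] at hc
      obtain rfl : j = N := by omega
      exact ⟨hy, hJ⟩
    · simp only [Expr.cost]
      rw [show 1 + 1 + 1 + (T + 4) = T + 7 by ring]
      omega
  · rintro k s ⟨j, hj, hx, hy, hJ⟩ hc
    simp only [Expr.eval] at hc
    refine ⟨k - 1, by omega, ?_⟩
    refine Ends.seq (hstep j (by omega) s hx hy hJ) fun s' ⟨h1, h2, h3⟩ => Ends.assign ?_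
    refine ⟨j + 1, by omega, ?_, ?_, ?_⟩
    · simp [h1]
    · simp [hxy.symm, h2]
    · simpa [h1] using h3

end RAM

/-! ## The bag filling program -/

namespace BagFilling

open RAM

/-- Run `p` if the item in register `12` is in the range on offer. -/
def inRange (p : Prog) : Prog :=
  .branch (.reg 12) (.reg 7) .skip (.branch (.reg 12) (.add (.reg 6) (.const 1)) p .skip)

/-- Compute the value of the free items for the agent in register `8`, and, up to a factor, that of
the free items on offer. -/
def computeSums : Prog :=
  .seq (.assign 11 (.const 0)) <|
  .seq (forLoop 12 8 (.assign 11 (.add (.reg 11) (.reg 1)))) <|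
  .seq (.assign 9 (.const 0)) <|
  .seq (.assign 10 (.const 0)) <|
  .seq (forLoop 12 1 (.branch (.cell 6 (.reg 12)) (.const 1)
    (.seq (.assign 10 (.add (.reg 10) (.cell 5 (.add (.reg 11) (.reg 12)))))
      (inRange (.assign 9 (.add (.reg 9) (.cell 5 (.add (.reg 11) (.reg 12)))))))
    .skip)) <|
  .seq (.assign 13 (.const 0)) <|
  forLoop 12 2 (.assign 13 (.add (.reg 13) (.add (.reg 9) (.reg 9))))

/-- Hand out the free items on offer to the agent in register `8`. -/
def giveBag : Prog :=
  .seq (forLoop 12 1 (.branch (.cell 6 (.reg 12)) (.const 1)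
    (inRange (.seq (.store 4 (.reg 12) (.reg 8)) (.store 6 (.reg 12) (.const 1)))) .skip)) <|
  .seq (.store 7 (.reg 8) (.const 1)) <|
  .assign 2 (.sub (.reg 2) (.const 1))

/-- Offer the free items in a range to the agent in register `8`. -/
def offerProg : Prog :=
  .branch (.cell 7 (.reg 8)) (.const 1)
    (.seq computeSums (.branch (.reg 10) (.reg 13) giveBag .skip)) .skip

theorem ends_inRange {p : Prog} {s : State} {T : ℕ} {Q : State → Prop} (hT : 1 ≤ T)
    (h : s.reg 7 ≤ s.reg 12 ∧ s.reg 12 < s.reg 6 + 1 → Ends p s T Q)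
    (h' : ¬ (s.reg 7 ≤ s.reg 12 ∧ s.reg 12 < s.reg 6 + 1) → Q s) :
    Ends (inRange p) s (T + 8) Q := by
  refine (Ends.branch (T := T + 5) (fun h1 => ?_) fun h1 => ?_).le ?_
  · simp only [Expr.eval] at h1
    exact (Ends.skip (h' (by omega))).le (by omega)
  · simp only [Expr.eval] at h1
    refine (Ends.branch (T := T) (fun h2 => ?_) fun h2 => ?_).le ?_
    · simp only [Expr.eval] at h2
      exact h (by omega)
    · simp only [Expr.eval] at h2
      exact (Ends.skip (h' (by omega))).le hT
    · simp only [Expr.cost]; omega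
  · simp only [Expr.cost]; omega

/-- The value of the `k`-th item if it is free. -/
def freeValue (M : ℕ → ℕ → ℕ) (row k : ℕ) : ℕ := if M 6 k = 0 then M 5 (row + k) else 0

/-- The value of the `k`-th item if it is free and in range. -/
def bagValue (M : ℕ → ℕ → ℕ) (lo hi row k : ℕ) : ℕ :=
  if M 6 k = 0 ∧ lo ≤ k ∧ k < hi then M 5 (row + k) else 0

/-- The two states differ at most in the registers from `K` on. -/
def SameBelow (K : ℕ) (s s' : State) : Prop := s'.mem = s.mem ∧ ∀ y < K, s'.reg y = s.reg y

theorem SameBelow.refl (K : ℕ) (s : State) : SameBelow K s s := ⟨rfl, fun _ _ => rfl⟩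

theorem SameBelow.setReg {K : ℕ} {s s' : State} (h : SameBelow K s s') {x : ℕ} (hx : K ≤ x)
    (v : ℕ) : SameBelow K s (s'.setReg x v) := by
  refine ⟨h.1, fun y hy => ?_⟩
  rw [State.setReg_reg, if_neg (by omega)]
  exact h.2 y hy

/-- Repeated addition replaces both products, the row offset and the factor given by the number of
active agents; each takes at most `n` rounds. -/
theorem ends_computeSums (s : State) :
    Ends computeSums s (18 * s.reg 8 + 37 * s.reg 1 + 20 * s.reg 2 + 100) fun s' =>
      SameBelow 9 s s' ∧
      s'.reg 10 = ∑ k ∈ Finset.range (s.reg 1), freeValue s.mem (s.reg 1 * s.reg 8) k ∧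
      s'.reg 13 = 2 * (s.reg 2 * ∑ k ∈ Finset.range (s.reg 1),
        bagValue s.mem (s.reg 7) (s.reg 6 + 1) (s.reg 1 * s.reg 8) k) := by
  unfold computeSums
  refine Ends.le (Ends.assign_seq <| Ends.seq (Ends.forLoop (T := 4) (N := s.reg 8)
    (J := fun k s' => SameBelow 9 s s' ∧ s'.reg 11 = s.reg 1 * k) (by norm_num) (by simp)
    ?_ ?_) fun s₁ h₁ => Ends.assign_seq <| Ends.assign_seq <|
      Ends.seq (Ends.forLoop (T := 30) (N := s.reg 1)
        (J := fun k s' => SameBelow 9 s s' ∧ s'.reg 11 = s.reg 1 * s.reg 8 ∧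
          s'.reg 10 = ∑ k ∈ Finset.range k, freeValue s.mem (s.reg 1 * s.reg 8) k ∧
          s'.reg 9 = ∑ k ∈ Finset.range k,
            bagValue s.mem (s.reg 7) (s.reg 6 + 1) (s.reg 1 * s.reg 8) k) (by norm_num) ?_
        ?_ ?_) fun s₂ h₂ => Ends.assign_seq <| Ends.imp (Ends.forLoop (T := 6) (N := s.reg 2)
          (J := fun k s' => SameBelow 9 s s' ∧ s'.reg 10 = s₂.reg 10 ∧ s'.reg 9 = s₂.reg 9 ∧
            s'.reg 13 = 2 * (k * s₂.reg 9)) (by norm_num) ?_ ?_ ?_) ?_) ?_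
  · exact ⟨((SameBelow.refl 9 s).setReg (by norm_num) _).setReg (by norm_num) _, by simp⟩
  · rintro k - s' hk h8 ⟨hs, h11⟩
    refine Ends.assign ⟨by simp [hk], by simp [h8], (hs.setReg (by norm_num) _).setReg
      (by norm_num) _, ?_⟩
    have := hs.2 1 (by norm_num)
    simp [h11, this, Nat.mul_add]
  · simp [h₁.2.1.2 1]
  · exact ⟨((h₁.2.1.setReg (by norm_num) _).setReg (by norm_num) _).setReg (by norm_num) _,
      by simp [h₁.2.2], by simp, by simp⟩
  · rintro k hk s' hs12 hs1 ⟨hs, h11, h10, h9⟩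
    have hs6 := hs.2 6 (by norm_num)
    have hs7 := hs.2 7 (by norm_num)
    refine Ends.le (Ends.branch (T := 24) (fun hc => ?_) fun hc => ?_) ?_
    · simp only [Expr.eval, hs12, Nat.lt_one_iff, hs.1] at hc
      refine Ends.le (Ends.assign_seq (ends_inRange (T := 7) (by norm_num) (fun hr => ?_)
        fun hr => ?_)) (by simp)
      · refine Ends.assign ⟨by simp [hs12], by simp [hs1],
          ((hs.setReg (by norm_num) _).setReg (by norm_num) _).setReg (by norm_num) _,
          by simp [h11], ?_, ?_⟩
        · simp [h10, h11, hs12, hs.1, Finset.sum_range_succ, freeValue, hc]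
        · simp only [State.setReg_reg, hs12, hs6, hs7] at hr
          norm_num at hr
          simp [h9, h11, hs12, hs.1, Finset.sum_range_succ, bagValue, hc, hr]
      · refine ⟨by simp [hs12], by simp [hs1],
          (hs.setReg (by norm_num) _).setReg (by norm_num) _, by simp [h11], ?_, ?_⟩
        · simp [h10, h11, hs12, hs.1, Finset.sum_range_succ, freeValue, hc]
        · simp only [State.setReg_reg, hs12, hs6, hs7] at hr
          norm_num at hr
          simp [h9, Finset.sum_range_succ, bagValue, hc]
          omega
    · simp only [Expr.eval, hs12, Nat.lt_one_iff, hs.1] at hc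
      refine Ends.le (Ends.skip ⟨hs12, hs1, hs.setReg (by norm_num) _, by simp [h11], ?_, ?_⟩)
        (by norm_num)
      · simp [h10, Finset.sum_range_succ, freeValue, hc]
      · simp [h9, Finset.sum_range_succ, bagValue, hc]
    · simp
  · simp [h₂.2.1.2 2]
  · exact ⟨(h₂.2.1.setReg (by norm_num) _).setReg (by norm_num) _, by simp, by simp, by simp⟩
  · rintro k - s' hk h2 ⟨hs, h10, h9, h13⟩
    refine Ends.assign ⟨by simp [hk], by simp [h2], (hs.setReg (by norm_num) _).setReg
      (by norm_num) _, by simp [h10], by simp [h9], ?_⟩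
    simp [h13, h9]
    ring
  · rintro s' ⟨-, hs, h10, h9, h13⟩
    exact ⟨hs, h10.trans h₂.2.2.2.1, by rw [h13, h₂.2.2.2.2]⟩
  · simp only [Expr.cost]
    omega

theorem ends_giveBag (s : State) :
    Ends giveBag s (26 * s.reg 1 + 100) fun s' =>
      (∀ y, 3 ≤ y → y < 9 → s'.reg y = s.reg y) ∧ s'.reg 0 = s.reg 0 ∧ s'.reg 1 = s.reg 1 ∧
      s'.reg 2 = s.reg 2 - 1 ∧ s'.mem 5 = s.mem 5 ∧
      (∀ i, s'.mem 7 i = if i = s.reg 8 then 1 else s.mem 7 i) ∧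
      ∀ b < s.reg 1,
        (s'.mem 6 b = if s.mem 6 b = 0 ∧ s.reg 7 ≤ b ∧ b < s.reg 6 + 1 then 1 else s.mem 6 b) ∧
        (s'.mem 4 b = if s.mem 6 b = 0 ∧ s.reg 7 ≤ b ∧ b < s.reg 6 + 1 then s.reg 8
          else s.mem 4 b) := by
  unfold giveBag
  refine Ends.le (Ends.seq (Ends.forLoop (T := 19) (N := s.reg 1)
    (J := fun k s' => (∀ y < 9, s'.reg y = s.reg y) ∧ s'.mem 5 = s.mem 5 ∧ s'.mem 7 = s.mem 7 ∧
      ∀ b, (s'.mem 6 b = if b < k ∧ s.mem 6 b = 0 ∧ s.reg 7 ≤ b ∧ b < s.reg 6 + 1 then 1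
          else s.mem 6 b) ∧
        (s'.mem 4 b = if b < k ∧ s.mem 6 b = 0 ∧ s.reg 7 ≤ b ∧ b < s.reg 6 + 1 then s.reg 8
          else s.mem 4 b))
    (by norm_num) rfl ?_ ?_) fun s₁ h₁ => Ends.store_seq <| Ends.assign ?_) ?_
  · refine ⟨fun y hy => ?_, rfl, rfl, fun b => by simp⟩
    rw [State.setReg_reg, if_neg (by omega)]
  · rintro k hk s' hs12 hs1 ⟨hs, h5, h7, h64⟩
    have hs6 := hs 6 (by norm_num)
    have hs7 := hs 7 (by norm_num)
    have hs8 := hs 8 (by norm_num)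
    have hk6 : s'.mem 6 k = s.mem 6 k := by simp [(h64 k).1]
    -- If item `k` is not in the bag, the descriptions after `k` and after `k + 1` items coincide.
    have hskip : ¬ (s.mem 6 k = 0 ∧ s.reg 7 ≤ k ∧ k < s.reg 6 + 1) → ∀ b,
        ((b < k ∧ s.mem 6 b = 0 ∧ s.reg 7 ≤ b ∧ b < s.reg 6 + 1) ↔
          (b < k + 1 ∧ s.mem 6 b = 0 ∧ s.reg 7 ≤ b ∧ b < s.reg 6 + 1)) := by
      intro h b
      refine and_congr_left fun hb => ?_
      rcases eq_or_ne b k with rfl | hne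
      · exact absurd hb h
      · omega
    have hno : ¬ (s.mem 6 k = 0 ∧ s.reg 7 ≤ k ∧ k < s.reg 6 + 1) →
        s'.reg 12 = k ∧ s'.reg 1 = s.reg 1 ∧
        (∀ y < 9, (s'.setReg 12 (k + 1)).reg y = s.reg y) ∧
        (s'.setReg 12 (k + 1)).mem 5 = s.mem 5 ∧ (s'.setReg 12 (k + 1)).mem 7 = s.mem 7 ∧
        ∀ b, ((s'.setReg 12 (k + 1)).mem 6 b =
            if b < k + 1 ∧ s.mem 6 b = 0 ∧ s.reg 7 ≤ b ∧ b < s.reg 6 + 1 then 1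
            else s.mem 6 b) ∧
          ((s'.setReg 12 (k + 1)).mem 4 b =
            if b < k + 1 ∧ s.mem 6 b = 0 ∧ s.reg 7 ≤ b ∧ b < s.reg 6 + 1 then s.reg 8
            else s.mem 4 b) := by
      intro h
      refine ⟨hs12, hs1, fun y hy => ?_, h5, h7, fun b => ?_⟩
      · rw [State.setReg_reg, if_neg (by omega)]
        exact hs y hy
      · simp only [State.setReg_mem, ← hskip h b]
        exact h64 b
    refine Ends.le (Ends.branch (T := 15) (fun hc => ?_) fun hc => ?_) (by simp)
    · simp only [Expr.eval, hs12, Nat.lt_one_iff, hk6] at hc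
      refine Ends.le (ends_inRange (T := 6) (by norm_num) (fun hr => ?_) fun hr => ?_)
        (by norm_num)
      · rw [hs12, hs6, hs7] at hr
        refine Ends.le (Ends.store_seq <| Ends.store
          ⟨by simp [hs12], by simp [hs1], fun y hy => ?_, ?_, ?_, fun b => ?_⟩)
          (by simp)
        · rw [State.setReg_reg, if_neg (by omega)]
          simp [hs y hy]
        · ext b
          simp [h5]
        · ext b
          simp [h7]
        · rcases eq_or_ne b k with rfl | hne
          · simp [hs12, hs8, hc, hr]
          · have h1 : b < k + 1 ↔ b < k := by omega
            simpa [hs12, hne, h1] using h64 b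
      · rw [hs12, hs6, hs7] at hr
        exact hno fun h => hr h.2
    · simp only [Expr.eval, hs12, Nat.lt_one_iff, hk6] at hc
      exact Ends.le (Ends.skip (hno fun h => hc h.1)) (by norm_num)
  · obtain ⟨-, hs, h5, h7, h64⟩ := h₁
    refine ⟨fun y h3 h9 => ?_, ?_, ?_, ?_, ?_, fun i => ?_, fun b hb => ?_⟩
    · rw [State.setReg_reg, if_neg (by omega)]
      exact hs y h9
    · simp [hs 0]
    · simp [hs 1]
    · simp [hs 2]
    · ext b
      simp [h5]
    · simp [h7, hs 8]
    · simpa [hb] using h64 b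
  · simp only [Expr.cost]
    omega

end BagFilling

/-! ### The program simulates bag filling. -/

namespace BagFilling

open RAM

variable {n m : ℕ} {v : Fin n → Fin m → ℕ}

variable (v) in
/-- The state `s` holds the values `v` and the configuration `c`. -/
structure Represents (c : Config n m) (s : State) : Prop where
  agents : s.reg 0 = n
  items : s.reg 1 = m
  active_card : s.reg 2 = c.active.card
  value : ∀ (i : Fin n) (b : Fin m), s.mem 5 (m * i + b) = v i b
  free : ∀ b : Fin m, s.mem 6 b = if b ∈ c.free then 0 else 1
  active : ∀ i : Fin n, s.mem 7 i = if i ∈ c.active then 0 else 1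
  owner : ∀ b : Fin m, s.mem 4 b = c.owner b

theorem Represents.congr {c : Config n m} {s s' : State} (h : Represents v c s)
    (hmem : s'.mem = s.mem) (hreg : ∀ y < 3, s'.reg y = s.reg y) : Represents v c s' := by
  refine ⟨?_, ?_, ?_, ?_, ?_, ?_, ?_⟩
  · exact (hreg 0 (by norm_num)).trans h.agents
  · exact (hreg 1 (by norm_num)).trans h.items
  · exact (hreg 2 (by norm_num)).trans h.active_card
  all_goals rw [hmem]
  exacts [h.value, h.free, h.active, h.owner]

theorem Represents.setReg {c : Config n m} {s : State} (h : Represents v c s) {x : ℕ}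
    (hx : 3 ≤ x) (a : ℕ) : Represents v c (s.setReg x a) := by
  refine h.congr rfl fun y hy => ?_
  rw [State.setReg_reg, if_neg (by omega)]

theorem Represents.sum_freeValue {c : Config n m} {s : State} (h : Represents v c s) (i : Fin n) :
    ∑ k ∈ Finset.range m, freeValue s.mem (m * i) k = ∑ b ∈ c.free, v i b := by
  have : c.free = Finset.univ.filter (· ∈ c.free) := by simp
  rw [Finset.sum_range, this, Finset.sum_filter]
  refine Finset.sum_congr rfl fun b _ => ?_
  by_cases hb : b ∈ c.free <;> simp [freeValue, h.free, h.value, hb]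

theorem Represents.sum_bagValue {c : Config n m} {s : State} (h : Represents v c s) (i : Fin n)
    (lo hi : ℕ) :
    ∑ k ∈ Finset.range m, bagValue s.mem lo hi (m * i) k = ∑ b ∈ c.bag lo hi, v i b := by
  have : c.bag lo hi = Finset.univ.filter fun b => b ∈ c.free ∧ lo ≤ b ∧ (b : ℕ) < hi := by
    ext b; simp [Config.bag]
  rw [Finset.sum_range, this, Finset.sum_filter]
  refine Finset.sum_congr rfl fun b _ => ?_
  by_cases hb : b ∈ c.free <;> simp [bagValue, h.free, h.value, hb]

theorem ends_offerProg {c : Config n m} {s : State} (h : Represents v c s) {i : Fin n} {lo b : ℕ}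
    (h6 : s.reg 6 = b) (h7 : s.reg 7 = lo) (h8 : s.reg 8 = i) :
    Ends offerProg s (64 * (n + m) + 220) fun s' =>
      Represents v (c.offer v i lo (b + 1)) s' ∧ ∀ y, 3 ≤ y → y < 9 → s'.reg y = s.reg y := by
  have hcard : c.active.card ≤ n := by simpa using Finset.card_le_univ c.active
  have hi := i.2
  refine Ends.le (Ends.branch (T := 38 * n + 63 * m + 210) (fun hc => ?_) fun hc => ?_) ?_
  · simp only [Expr.eval, h8, h.active, Nat.lt_one_iff, ite_eq_left_iff, one_ne_zero,
      imp_false, not_not] at hc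
    refine Ends.le (Ends.seq (ends_computeSums s) fun s₁ ⟨hs, h10, h13⟩ =>
      Ends.branch (T := 26 * m + 100) (fun ha => ?_) fun ha => ?_) ?_
    · simp only [Expr.eval, h10, h13, h.items, h8, h.active_card, h6, h7, h.sum_freeValue,
        h.sum_bagValue] at ha
      rw [Config.offer_of_accepts ⟨hc, ha⟩]
      have h₁ : Represents v c s₁ := h.congr hs.1 fun y hy => hs.2 y (by omega)
      have h6₁ := (hs.2 6 (by norm_num)).trans h6
      have h7₁ := (hs.2 7 (by norm_num)).trans h7
      have h8₁ := (hs.2 8 (by norm_num)).trans h8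
      refine ((ends_giveBag s₁).imp ?_).le (by rw [h₁.items])
      rintro s₂ ⟨hr, r0, r1, r2, m5, m7, m64⟩
      rw [h₁.items, h6₁, h7₁, h8₁] at m64
      have hbag : ∀ t : Fin m, (s₁.mem 6 t = 0 ∧ lo ≤ t ∧ (t : ℕ) < b + 1) ↔
          t ∈ c.bag lo (b + 1) := by
        intro t
        simp [h₁.free, Config.bag]
      refine ⟨⟨r0.trans h₁.agents, r1.trans h₁.items, ?_, ?_, ?_, ?_, ?_⟩, fun y h3 h9 =>
        (hr y h3 h9).trans (hs.2 y h9)⟩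
      · rw [r2, h₁.active_card]
        exact (Finset.card_erase_of_mem hc).symm
      · rw [m5]
        exact h₁.value
      · intro t
        rw [(m64 t t.2).1, h₁.free t]
        simp only [← h₁.free t, hbag t, Config.give, Finset.mem_sdiff]
        by_cases h1 : t ∈ c.bag lo (b + 1) <;> simp [h1, h₁.free t]
      · intro j
        rw [m7, h8₁, h₁.active j]
        simp only [Config.give, Finset.mem_erase, Fin.val_inj]
        by_cases hj : j = i <;> simp [hj]
      · intro t
        rw [(m64 t t.2).2, h₁.owner t]
        simp only [hbag t, Config.give]
        split_ifs <;> rfl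
    · simp only [Expr.eval, h10, h13, h.items, h8, h.active_card, h6, h7, h.sum_freeValue,
        h.sum_bagValue] at ha
      rw [Config.offer_of_not_accepts fun h' => ha h'.2]
      exact (Ends.skip ⟨h.congr hs.1 fun y hy => hs.2 y (by omega), fun y _ h9 => hs.2 y h9⟩).le
        (by omega)
    · rw [h8, h.items, h.active_card]
      simp only [Expr.cost]
      omega
  · simp only [Expr.eval, h8, h.active, Nat.lt_one_iff, ite_eq_left_iff, one_ne_zero,
      imp_false, not_not] at hc
    rw [Config.offer_of_not_accepts fun h' => hc h'.1]
    exact (Ends.skip ⟨h, fun _ _ _ => rfl⟩).le (by omega)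
  · simp only [Expr.cost]
    omega

/-- Hand out single items, then larger bundles. -/
def bagFillingProg : Prog :=
  .seq (.assign 2 (.reg 0)) <|
  .seq (forLoop 3 0 (forLoop 6 1 (.seq (.assign 7 (.reg 6)) (forLoop 8 0 offerProg)))) <|
  .seq (.assign 7 (.const 0)) (forLoop 6 1 (forLoop 8 0 offerProg))

/-- A bound on the time to make an offer to every agent. -/
def roundTime (n m : ℕ) : ℕ := (n + 1) * (64 * (n + m) + 220 + 7) + 2

/-- Register `7` is the lower end of the range on offer: equal to the current item in the first
phase, so that bags are single items, and zero in the second, so that bags are prefixes. -/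
theorem ends_bagFillingProg {s : State} (a : Fin n) (h0 : s.reg 0 = n) (h1 : s.reg 1 = m)
    (h4 : ∀ b : Fin m, s.mem 4 b = a) (h5 : ∀ (i : Fin n) (b : Fin m), s.mem 5 (m * i + b) = v i b)
    (h6 : ∀ b : Fin m, s.mem 6 b = 0) (h7 : ∀ i : Fin n, s.mem 7 i = 0) :
    Ends bagFillingProg s
      ((n + 1) * ((m + 1) * (2 + roundTime n m + 7) + 2 + 7) + 2 +
        ((m + 1) * (roundTime n m + 7) + 2) + 4) fun s' =>
        ∃ c : Config n m, (∀ i, c.Satisfied v i) ∧ ∀ b : Fin m, s'.mem 4 b = c.owner b := by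
  refine Ends.le (Ends.assign_seq <| Ends.seq (Ends.forLoop
    (J := fun r s => ∃ c, Represents v c s ∧ SingleProgress v r 0 0 c) (N := n)
    (T := (m + 1) * (2 + roundTime n m + 7) + 2) (by norm_num) ?_ ?_ ?_)
    fun s₁ ⟨_, c₀, hc₀, hs₀⟩ => Ends.assign_seq <| Ends.imp (Ends.forLoop
      (J := fun b s => s.reg 7 = 0 ∧ ∃ c, Represents v c s ∧ BagInv v c₀ b 0 c) (N := m)
      (T := roundTime n m) (by norm_num) ?_ ?_ ?_) ?_) ?_
  · simp [h0]
  · refine ⟨Config.start a, ⟨?_, ?_, ?_, ?_, ?_, ?_, ?_⟩, singleProgress_start a⟩ <;>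
      simp [h0, h1, h4, h5, h6, h7, Config.start]
  · rintro r - s hr - ⟨c, hc, hp⟩
    refine (Ends.forLoop (N := m) (T := 2 + roundTime n m)
      (J := fun b s => s.reg 3 = r ∧ ∃ c, Represents v c s ∧ SingleProgress v r b 0 c)
      (by norm_num) hc.items ?_ ?_).imp ?_
    · exact ⟨by simp [hr], c, hc.setReg (by norm_num) _, hp⟩
    · rintro b hb s h6 h1 ⟨h3, c, hc, hp⟩
      refine Ends.assign_seq <| (Ends.forLoop (N := n) (T := 64 * (n + m) + 220)
        (J := fun i s => s.reg 3 = r ∧ s.reg 6 = b ∧ s.reg 7 = b ∧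
          ∃ c, Represents v c s ∧ SingleProgress v r b i c) (by norm_num) ?_ ?_ ?_).imp ?_
      · simp [hc.agents]
      · exact ⟨by simp [h3], by simp [h6], by simp [h6], c,
          (hc.setReg (by norm_num) _).setReg (by norm_num) _, hp⟩
      · rintro i hi s h8 h0 ⟨h3, h6, h7, c, hc, hp⟩
        refine (ends_offerProg (i := ⟨i, hi⟩) hc h6 h7 h8).imp ?_
        rintro s' ⟨hc', hr'⟩
        exact ⟨(hr' 8 (by norm_num) (by norm_num)).trans h8, hc'.agents,
          by simp [hr' 3, h3], by simp [hr' 6, h6], by simp [hr' 7, h7], _,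
          hc'.setReg (by norm_num) _,
          SingleProgress.offer (b := ⟨b, hb⟩) (i := ⟨i, hi⟩) hp⟩
      · rintro s' ⟨-, h3, h6, h7, c, hc, hp⟩
        exact ⟨h6, hc.items, by simp [h3], c, hc.setReg (by norm_num) _, hp.next_item⟩
    · rintro s' ⟨-, h3, c, hc, hp⟩
      exact ⟨h3, hc.agents, c, hc.setReg (by norm_num) _, hp.next_pass⟩
  · simp [hc₀.items]
  · exact ⟨by simp, c₀, (hc₀.setReg (by norm_num) _).setReg (by norm_num) _, bagInv_start hs₀.1⟩
  · rintro b hb s h6 h1 ⟨h7, c, hc, hp⟩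
    refine (Ends.forLoop (N := n) (T := 64 * (n + m) + 220)
      (J := fun i s => s.reg 6 = b ∧ s.reg 7 = 0 ∧
        ∃ c, Represents v c s ∧ BagInv v c₀ b i c) (by norm_num) hc.agents ?_ ?_).imp ?_
    · exact ⟨by simp [h6], by simp [h7], c, hc.setReg (by norm_num) _, hp⟩
    · rintro i hi s h8 h0 ⟨h6, h7, c, hc, hp⟩
      refine (ends_offerProg (i := ⟨i, hi⟩) hc h6 h7 h8).imp ?_
      rintro s' ⟨hc', hr'⟩
      exact ⟨(hr' 8 (by norm_num) (by norm_num)).trans h8, hc'.agents,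
        by simp [hr' 6, h6], by simp [hr' 7, h7], _, hc'.setReg (by norm_num) _,
        BagInv.offer (b := ⟨b, hb⟩) (i := ⟨i, hi⟩) hs₀.1 hs₀.stable hp⟩
    · rintro s' ⟨-, h6, h7, c, hc, hp⟩
      exact ⟨h6, hc.items, by simp [h7], c, hc.setReg (by norm_num) _, hp.next_item⟩
  · rintro s' ⟨-, -, c, hc, hp⟩
    exact ⟨c, hp.satisfied hs₀.1, hc.owner⟩
  · simp only [Expr.cost]
    omega

end BagFilling

/-! ## Rounding rational numbers -/

namespace BagFilling

open RAM

/-- Write the largest power of two below a multiple of the fraction in cell `reg 15` of the arrays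
`0` and `1` to array `5`. -/
def roundItem : Prog :=
  .seq (.assign 18 (.cell 0 (.reg 15))) <|
  .seq (forLoop 21 16 (.assign 18 (.add (.reg 18) (.reg 18)))) <|
  .branch (.const 0) (.reg 18)
    (.seq (.assign 19 (.const 1)) <|
    .seq (.assign 20 (.cell 1 (.reg 15))) <|
    .seq (.loop (.add (.reg 20) (.reg 20)) (.add (.reg 18) (.const 1))
      (.seq (.assign 20 (.add (.reg 20) (.reg 20))) (.assign 19 (.add (.reg 19) (.reg 19))))) <|
    .store 5 (.reg 15) (.reg 19)) .skip

/-- Round the matrix of fractions in the arrays `0` and `1` to powers of two. -/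
def roundProg : Prog :=
  .seq (.assign 14 (.const 0)) <|
  .seq (forLoop 15 0 (.assign 14 (.add (.reg 14) (.reg 1)))) <|
  .seq (.assign 16 (.const 0)) <|
  .seq (.assign 17 (.const 1)) <|
  .seq (forLoop 15 14 (.loop (.reg 17) (.cell 1 (.reg 15))
    (.seq (.assign 17 (.add (.reg 17) (.reg 17))) (.assign 16 (.add (.reg 16) (.const 1)))))) <|
  forLoop 15 14 roundItem

/-- If the numerator is positive, `hqe` lets the search start from the power 1; it stops at the last
power of two that fits, which is within a factor of two. If it is zero, the cell keeps its initial
zero. -/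
theorem ends_roundItem {s : State} {k e L : ℕ} (h15 : s.reg 15 = k) (h16 : s.reg 16 = e)
    (heL : e ≤ L) (hp : s.mem 0 k < 2 ^ L) (hq : 0 < s.mem 1 k) (hqe : s.mem 1 k ≤ 2 ^ e)
    (h5 : s.mem 5 k = 0) :
    Ends roundItem s (41 * (L + 1) + 40) fun s' =>
      (∀ y < 18, s'.reg y = s.reg y) ∧ (∀ a ≠ 5, s'.mem a = s.mem a) ∧
      (∀ j ≠ k, s'.mem 5 j = s.mem 5 j) ∧
      s'.mem 5 k * s.mem 1 k ≤ s.mem 0 k * 2 ^ e ∧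
      s.mem 0 k * 2 ^ e ≤ 2 * (s'.mem 5 k * s.mem 1 k) := by
  have hPL : s.mem 0 k * 2 ^ e < 2 ^ (2 * L) := by
    calc s.mem 0 k * 2 ^ e < 2 ^ L * 2 ^ e := Nat.mul_lt_mul_of_pos_right hp (by positivity)
      _ ≤ 2 ^ L * 2 ^ L := Nat.mul_le_mul_left _ (Nat.pow_le_pow_right (by norm_num) heL)
      _ = 2 ^ (2 * L) := by rw [← pow_add, two_mul]
  refine Ends.le (Ends.assign_seq <| Ends.seq (Ends.forLoop (T := 4) (N := e)
    (J := fun i s' => SameBelow 18 s s' ∧ s'.reg 18 = s.mem 0 k * 2 ^ i) (by norm_num) ?_ ?_ ?_)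
    fun s₁ ⟨_, hs, h18⟩ => Ends.branch (T := 30 * L + 25) (fun hc => ?_) fun hc => ?_) ?_
  · simp [h16]
  · exact ⟨((SameBelow.refl 18 s).setReg (by norm_num) _).setReg (by norm_num) _, by simp [h15]⟩
  · rintro i - s' h21 h16 ⟨hs, h18⟩
    refine Ends.assign ⟨by simp [h21], by simp [h16],
      (hs.setReg (by norm_num) _).setReg (by norm_num) _, ?_⟩
    simp [h18, pow_succ]
    ring
  · simp only [Expr.eval, h18] at hc
    have hp0 : 0 < s.mem 0 k := pos_of_mul_pos_left hc (Nat.zero_le _)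
    have h15₁ := (hs.2 15 (by norm_num)).trans h15
    refine Ends.le (Ends.assign_seq <| Ends.assign_seq <| Ends.seq
      (Ends.loop (k := 2 * L) (T := 8) (Inv := fun f s' => SameBelow 18 s s' ∧
        s'.reg 18 = s.mem 0 k * 2 ^ e ∧ ∃ j, j + f = 2 * L ∧ s'.reg 19 = 2 ^ j ∧
          s'.reg 20 = 2 ^ j * s.mem 1 k ∧ 2 ^ j * s.mem 1 k ≤ s.mem 0 k * 2 ^ e) ?_ ?_)
      fun s₂ h₂ => Ends.store ?_) ?_
    · rintro f s' ⟨hs, h18, j, hj, h19, h20, hle⟩ hcond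
      simp only [Expr.eval, h20, h18] at hcond
      have hle' : 2 ^ (j + 1) * s.mem 1 k ≤ s.mem 0 k * 2 ^ e := by
        rw [pow_succ, mul_right_comm]
        omega
      -- A power that still fits is below `2 ^ (2 * L)`, which bounds the number of doublings.
      have hj' : j + 1 < 2 * L := by
        rw [← Nat.pow_lt_pow_iff_right (by norm_num : 1 < 2)]
        exact lt_of_le_of_lt ((Nat.le_mul_of_pos_right _ hq).trans hle') hPL
      refine ⟨f - 1, by omega, Ends.assign_seq (Ends.assign
        ⟨(hs.setReg (by norm_num) _).setReg (by norm_num) _, by simp [h18], j + 1, by omega,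
          ?_, ?_, hle'⟩)⟩
      · simp [h19, pow_succ]
        ring
      · simp [h20, pow_succ]
        ring
    · refine ⟨(hs.setReg (by norm_num) _).setReg (by norm_num) _, by simp [h18], 0, by simp,
        by simp, by simp [h15₁, hs.1], ?_⟩
      rw [pow_zero, one_mul]
      exact hqe.trans (Nat.le_mul_of_pos_left _ hp0)
    · obtain ⟨⟨f, hs, h18, j, hj, h19, h20, hle⟩, hcond⟩ := h₂
      have h15₂ := (hs.2 15 (by norm_num)).trans h15
      simp only [Expr.eval, h20, h18] at hcond
      refine ⟨fun y hy => ?_, fun a ha => ?_, fun i hi => ?_, ?_, ?_⟩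
      · simpa using hs.2 y hy
      · ext i
        simp [ha, hs.1]
      · simp [h15₂, hi, hs.1]
      · simpa [h15₂, h19] using hle
      · simp only [Expr.eval, State.setMem_mem, h15₂, h19, and_self, if_true]
        omega
    · simp only [Expr.cost]
      omega
  · simp only [Expr.eval, h18, not_lt, Nat.le_zero] at hc
    refine (Ends.skip ⟨hs.2, fun a _ => by rw [hs.1], fun j _ => by rw [hs.1], ?_, ?_⟩).le
      (by omega)
    · simp [hs.1, h5]
    · simp [hc]
  · simp only [Expr.cost]
    omega

/-- A bound on the running time of `roundProg` for `n` rows, `N` entries and numerals of length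
`L`. -/
def roundProgTime (n N L : ℕ) : ℕ :=
  ((n + 1) * 11 + 2) + ((N + 1) * ((L + 1) * 12 + 7) + 2) +
    ((N + 1) * (41 * (L + 1) + 40 + 7) + 2) + 10

/-- One exponent `e` serves all entries: it is raised until `2 ^ e` reaches every denominator, and
it stays at most `L`. -/
theorem ends_roundProg {s : State} {n m L : ℕ} (h0 : s.reg 0 = n) (h1 : s.reg 1 = m)
    (hp : ∀ k < m * n, s.mem 0 k < 2 ^ L) (hq : ∀ k < m * n, 0 < s.mem 1 k ∧ s.mem 1 k < 2 ^ L)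
    (h5 : ∀ k, s.mem 5 k = 0) :
    Ends roundProg s (roundProgTime n (m * n) L) fun s' =>
      s'.reg 0 = n ∧ s'.reg 1 = m ∧ (∀ a ≠ 5, s'.mem a = s.mem a) ∧
      ∃ e, ∀ k < m * n, s'.mem 5 k * s.mem 1 k ≤ s.mem 0 k * 2 ^ e ∧
        s.mem 0 k * 2 ^ e ≤ 2 * (s'.mem 5 k * s.mem 1 k) := by
  refine Ends.le (Ends.assign_seq <| Ends.seq (Ends.forLoop (T := 4) (N := n)
    (J := fun k s' => SameBelow 14 s s' ∧ s'.reg 14 = m * k) (by norm_num) (by simp [h0]) ?_ ?_)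
    fun s₁ ⟨_, hs₁, h14⟩ => Ends.assign_seq <| Ends.assign_seq <|
      Ends.seq (Ends.forLoop (T := (L + 1) * 12) (N := m * n)
        (J := fun k s' => SameBelow 14 s s' ∧ ∃ e ≤ L, s'.reg 16 = e ∧ s'.reg 17 = 2 ^ e ∧
          ∀ j < k, s.mem 1 j ≤ 2 ^ e) (by norm_num) ?_ ?_ ?_)
      fun s₂ ⟨h14, hs₂, e, heL, h16, _, hqe⟩ => Ends.imp
        (Ends.forLoop (T := 41 * (L + 1) + 40) (N := m * n)
        (J := fun k s' => (∀ y < 14, s'.reg y = s.reg y) ∧ s'.reg 16 = e ∧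
          (∀ a ≠ 5, s'.mem a = s.mem a) ∧ (∀ j, k ≤ j → s'.mem 5 j = 0) ∧
          ∀ j < k, s'.mem 5 j * s.mem 1 j ≤ s.mem 0 j * 2 ^ e ∧
            s.mem 0 j * 2 ^ e ≤ 2 * (s'.mem 5 j * s.mem 1 j)) (by norm_num) h14 ?_ ?_) ?_) ?_
  · exact ⟨((SameBelow.refl 14 s).setReg (by norm_num) _).setReg (by norm_num) _, by simp⟩
  · rintro k - s' h15 h0 ⟨hs, h14⟩
    refine Ends.assign ⟨by simp [h15], by simp [h0],
      (hs.setReg (by norm_num) _).setReg (by norm_num) _, ?_⟩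
    have := hs.2 1 (by norm_num)
    simp [h14, this, h1, Nat.mul_add]
  · simp [h14]
  · exact ⟨((hs₁.setReg (by norm_num) _).setReg (by norm_num) _).setReg (by norm_num) _, 0,
      Nat.zero_le _, by simp, by simp, fun j hj => absurd hj (by omega)⟩
  · rintro k hk s' h15 h14 ⟨hs, e, heL, h16, h17, hqe⟩
    refine (Ends.loop (k := L - e) (T := 8) (Inv := fun f s' => SameBelow 14 s s' ∧
      s'.reg 15 = k ∧ s'.reg 14 = m * n ∧ ∃ e, e + f = L ∧ s'.reg 16 = e ∧ s'.reg 17 = 2 ^ e ∧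
        ∀ j < k, s.mem 1 j ≤ 2 ^ e) ?_ ?_).imp ?_ |>.le ?_
    · rintro f s' ⟨hs, h15, h14, e, hf, h16, h17, hqe⟩ hc
      simp only [Expr.eval, h17, h15, hs.1] at hc
      have he : e < L := by
        rw [← Nat.pow_lt_pow_iff_right (by norm_num : 1 < 2)]
        exact hc.trans (hq k hk).2
      refine ⟨f - 1, by omega, Ends.assign_seq (Ends.assign
        ⟨(hs.setReg (by norm_num) _).setReg (by norm_num) _, by simp [h15], by simp [h14],
          e + 1, by omega, by simp [h16], ?_, fun j hj => (hqe j hj).trans ?_⟩)⟩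
      · simp [h17, pow_succ]
        ring
      · exact Nat.pow_le_pow_right (by norm_num) (by omega)
    · exact ⟨hs, h15, h14, e, by omega, h16, h17, hqe⟩
    · rintro s' ⟨⟨f, hs, h15, h14, e, hf, h16, h17, hqe⟩, hc⟩
      simp only [Expr.eval, h17, h15, hs.1, not_lt] at hc
      refine ⟨h15, h14, hs.setReg (by norm_num) _, e, by omega, by simp [h16], by simp [h17],
        fun j hj => ?_⟩
      rcases eq_or_ne j k with rfl | hne
      · exact hc
      · exact hqe j (by omega)
    · simp only [Expr.cost]
      gcongr
      omega
  · refine ⟨fun y hy => ?_, by simp [h16], fun a _ => by simp [hs₂.1], fun j _ => ?_,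
      fun j hj => absurd hj (by omega)⟩
    · rw [State.setReg_reg, if_neg (by omega)]
      exact hs₂.2 y hy
    · simp [hs₂.1, h5]
  · rintro k hk s' h15 h14 ⟨hs, h16, hmem, hz, hz'⟩
    have m0 := hmem 0 (by norm_num)
    have m1 := hmem 1 (by norm_num)
    refine (ends_roundItem h15 h16 heL (by rw [m0]; exact hp k hk)
      (by rw [m1]; exact (hq k hk).1) (by rw [m1]; exact hqe k hk) (hz k le_rfl)).imp ?_
    rintro s'' ⟨hr, hm, hm5, hk1, hk2⟩
    rw [m0, m1] at hk1 hk2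
    refine ⟨(hr 15 (by norm_num)).trans h15, (hr 14 (by norm_num)).trans h14, fun y hy => ?_,
      by simp [hr 16, h16], fun a ha => (hm a ha).trans (hmem a ha), fun j hj => ?_,
      fun j hj => ?_⟩
    · rw [State.setReg_reg, if_neg (by omega)]
      exact (hr y (by omega)).trans (hs y hy)
    · exact (hm5 j (by omega)).trans (hz j (by omega))
    · rcases eq_or_ne j k with rfl | hne
      · exact ⟨hk1, hk2⟩
      · simp only [State.setReg_mem, hm5 j hne]
        exact hz' j (by omega)
  · rintro s' ⟨-, hs, -, hmem, -, hz⟩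
    exact ⟨(hs 0 (by norm_num)).trans h0, (hs 1 (by norm_num)).trans h1, hmem, e, hz⟩
  · simp only [Expr.cost, roundProgTime]
    omega

end BagFilling

/-! ### From rounded values back to rational ones. -/

namespace BagFilling

/-- The constant 4 is the 2 of `Satisfied` times the 2 lost by rounding. Counting free items with
their default owner only enlarges his bundle. -/
theorem Config.Satisfied.exists_sum_le {n m : ℕ} {v : Fin n → Fin m → ℕ} {c : Config n m}
    {i : Fin n} (h : c.Satisfied v i) {V : Fin m → ℚ} {D : ℚ} (hD : 0 < D)
    (hle : ∀ b, (v i b : ℚ) ≤ D * V b) (hge : ∀ b, D * V b ≤ 2 * v i b) :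
    ∃ T : Finset (Fin m), Set.InjOn c.owner T ∧ (∀ t ∈ T, c.owner t ≠ i) ∧ T.card < n ∧
      ∑ b ∈ Tᶜ, V b ≤ 4 * ((n : ℚ) - T.card) * ∑ b with c.owner b = i, V b := by
  obtain ⟨T, -, hinj, hne, k, hk, hkn, hsum⟩ := h
  refine ⟨T, hinj, hne, by omega, ?_⟩
  have hk' : (n : ℚ) - T.card = k := by
    rw [← hkn]; push_cast; ring
  have h1 : ∑ b ∈ c.freeᶜ with c.owner b = i, v i b ≤ ∑ b with c.owner b = i, v i b :=
    Finset.sum_le_sum_of_subset (Finset.filter_subset_filter _ (Finset.subset_univ _))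
  have h2 : ∑ b ∈ Tᶜ, v i b ≤ 2 * (k * ∑ b with c.owner b = i, v i b) :=
    hsum.trans (by gcongr)
  have h3 : (∑ b ∈ Tᶜ, (v i b : ℚ)) ≤ 2 * (k * ∑ b with c.owner b = i, (v i b : ℚ)) := by
    exact_mod_cast h2
  rw [hk']
  refine le_of_mul_le_mul_left ?_ hD
  calc D * ∑ b ∈ Tᶜ, V b = ∑ b ∈ Tᶜ, D * V b := Finset.mul_sum _ _ _
    _ ≤ ∑ b ∈ Tᶜ, 2 * (v i b : ℚ) := Finset.sum_le_sum fun b _ => hge b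
    _ = 2 * ∑ b ∈ Tᶜ, (v i b : ℚ) := (Finset.mul_sum _ _ _).symm
    _ ≤ 2 * (2 * (k * ∑ b with c.owner b = i, (v i b : ℚ))) := by gcongr
    _ ≤ 2 * (2 * (k * ∑ b with c.owner b = i, D * V b)) := by
      gcongr with b _
      exact hle b
    _ = D * (4 * k * ∑ b with c.owner b = i, V b) := by
      rw [← Finset.mul_sum]; ring

end BagFilling

/-! ### Input layout and size bounds. -/

namespace NetworkExternalities

theorem rowMajor_apply {r c : ℕ} (M : Fin r → Fin c → ℕ) (i : Fin r) (j : Fin c) :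
    rowMajor M (c * i + j) = M i j := by
  have hk : (⟨(finProdFinEquiv (i, j) : ℕ), (finProdFinEquiv (i, j)).2⟩ : Fin (r * c)) =
    finProdFinEquiv (i, j) := rfl
  have he : c * (i : ℕ) + j = finProdFinEquiv (i, j) := by
    rw [finProdFinEquiv_apply_val, add_comm]
  rw [he, rowMajor, dif_pos (finProdFinEquiv (i, j)).2, hk, Equiv.symm_apply_apply]

theorem exists_eq_mul_add {r c k : ℕ} (hk : k < c * r) :
    ∃ (i : Fin r) (j : Fin c), k = c * i + j := by
  have hc : 0 < c := Nat.pos_of_mul_pos_right (Nat.zero_lt_of_lt hk)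
  exact ⟨⟨k / c, Nat.div_lt_of_lt_mul hk⟩, ⟨k % c, Nat.mod_lt _ hc⟩, (Nat.div_add_mod k c).symm⟩

theorem one_le_ratSize (q : ℚ) : 1 ≤ ratSize q := by
  have : 0 < Nat.size q.den := Nat.size_pos.2 q.pos
  unfold ratSize
  omega

namespace AllocInstance

variable (I : AllocInstance)

theorem ratSize_value_le_size (i : Fin I.n) (b : Fin I.m) : ratSize (I.value i b) ≤ I.size := by
  have h1 : ratSize (I.value i b) ≤ ∑ b, ratSize (I.value i b) :=
    Finset.single_le_sum (f := fun b => ratSize (I.value i b)) (fun _ _ => Nat.zero_le _)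
      (Finset.mem_univ b)
  have h2 : ∑ b, ratSize (I.value i b) ≤ ∑ i, ∑ b, ratSize (I.value i b) :=
    Finset.single_le_sum (f := fun i => ∑ b, ratSize (I.value i b)) (fun _ _ => Nat.zero_le _)
      (Finset.mem_univ i)
  unfold size
  omega

theorem mul_le_size : I.m * I.n ≤ I.size := by
  have h : ∑ _i : Fin I.n, ∑ _b : Fin I.m, 1 ≤ ∑ i, ∑ b, ratSize (I.value i b) :=
    Finset.sum_le_sum fun i _ => Finset.sum_le_sum fun b _ => one_le_ratSize _
  simp only [Finset.sum_const, Finset.card_univ, Fintype.card_fin, smul_eq_mul, mul_one] at h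
  rw [mul_comm]
  unfold size
  omega

theorem items_le_size : I.m ≤ I.size :=
  (Nat.le_mul_of_pos_right _ I.n_pos).trans I.mul_le_size

theorem agents_le_size : I.n ≤ I.size := by
  have h : ∑ _i : Fin I.n, ∑ _b : Fin I.n, 1 ≤ ∑ j, ∑ i, ratSize (I.weight j i) :=
    Finset.sum_le_sum fun i _ => Finset.sum_le_sum fun b _ => one_le_ratSize _
  simp only [Finset.sum_const, Finset.card_univ, Fintype.card_fin, smul_eq_mul, mul_one] at h
  have h' : I.n ≤ I.n * I.n := Nat.le_mul_of_pos_right _ I.n_pos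
  unfold size
  omega

theorem num_lt (i : Fin I.n) (b : Fin I.m) : (I.value i b).num.natAbs < 2 ^ I.size := by
  have := I.ratSize_value_le_size i b
  unfold ratSize at this
  exact Nat.size_le.1 (by omega)

theorem den_lt (i : Fin I.n) (b : Fin I.m) : (I.value i b).den < 2 ^ I.size := by
  have := I.ratSize_value_le_size i b
  unfold ratSize at this
  exact Nat.size_le.1 (by omega)

theorem value_eq (i : Fin I.n) (b : Fin I.m) :
    I.value i b = ((I.value i b).num.natAbs : ℚ) / (I.value i b).den := by
  have h : (((I.value i b).num.natAbs : ℤ) : ℚ) = (I.value i b).num := by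
    rw [Int.natAbs_of_nonneg (Rat.num_nonneg.2 (I.value_nonneg i b))]
  rw [← Int.cast_natCast, h, Rat.num_div_den]

end AllocInstance

end NetworkExternalities

/-! ### Running time and the final assembly. -/

open Polynomial in
/-- A polynomial bound on the running time. -/
noncomputable def timeBound : Polynomial ℕ :=
  (((X + 1) * 11 + 2) + ((X + 1) * ((X + 1) * 12 + 7) + 2) +
    ((X + 1) * (41 * (X + 1) + 40 + 7) + 2) + 10) +
  ((X + 1) * ((X + 1) * (2 + ((X + 1) * (64 * (X + X) + 220 + 7) + 2) + 7) + 2 + 7) + 2 +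
    ((X + 1) * (((X + 1) * (64 * (X + X) + 220 + 7) + 2) + 7) + 2) + 4)

theorem corollary1 :
    ∃ (prog : RAM.Prog) (p : Polynomial ℕ),
      ∀ (α : ℝ) (I : NetworkExternalities.AllocInstance),
        (∀ i, I.SelfReliant α i) →
          ∃ (t : ℕ) (s : RAM.State) (A : Fin I.m → Fin I.n),
            RAM.Runs prog I.input t s ∧ t ≤ p.eval I.size ∧
              I.Outputs s A ∧ I.IsEMMSAllocation (α / 4) A := by
  refine ⟨.seq BagFilling.roundProg BagFilling.bagFillingProg, timeBound, fun α I hα => ?_⟩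
  have hmem0 : ∀ (i : Fin I.n) (b : Fin I.m), I.input.mem 0 (I.m * i + b) = (I.value i b).num.natAbs :=
    NetworkExternalities.rowMajor_apply fun i b => (I.value i b).num.natAbs
  have hmem1 : ∀ (i : Fin I.n) (b : Fin I.m), I.input.mem 1 (I.m * i + b) = (I.value i b).den :=
    NetworkExternalities.rowMajor_apply fun i b => (I.value i b).den
  obtain ⟨t, s, hrun, ht, s₁, ⟨hmem, e, he⟩, c, hsat, hout⟩ :=
    RAM.Ends.seq (Q := fun s => ∃ s₁ : RAM.State, ((∀ a ≠ 5, s₁.mem a = I.input.mem a) ∧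
        ∃ e, ∀ k < I.m * I.n, s₁.mem 5 k * I.input.mem 1 k ≤ I.input.mem 0 k * 2 ^ e ∧
          I.input.mem 0 k * 2 ^ e ≤ 2 * (s₁.mem 5 k * I.input.mem 1 k)) ∧
        ∃ c : BagFilling.Config I.n I.m,
          (∀ i, c.Satisfied (fun (i : Fin I.n) (b : Fin I.m) => s₁.mem 5 (I.m * i + b)) i) ∧
          ∀ b : Fin I.m, s.mem 4 b = c.owner b)
      (BagFilling.ends_roundProg (s := I.input) (n := I.n) (m := I.m) (L := I.size) rfl rfl
        (fun k hk => by
          obtain ⟨i, b, rfl⟩ := NetworkExternalities.exists_eq_mul_add hk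
          rw [hmem0]
          exact I.num_lt i b)
        (fun k hk => by
          obtain ⟨i, b, rfl⟩ := NetworkExternalities.exists_eq_mul_add hk
          rw [hmem1]
          exact ⟨(I.value i b).pos, I.den_lt i b⟩)
        fun _ => rfl)
      (fun s₁ ⟨h0, h1, hmem, he⟩ =>
        (BagFilling.ends_bagFillingProg ⟨0, I.n_pos⟩ h0 h1
          -- Array `4` starts at zero, so agent 0 is the default owner of every item that stays free
          -- and the allocation is complete.
          (fun b => by rw [hmem 4 (by norm_num)]; rfl) (fun _ _ => rfl)
          (fun b => by rw [hmem 6 (by norm_num)]; rfl)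
          (fun i => by rw [hmem 7 (by norm_num)]; rfl)).imp
          fun s h => ⟨s₁, ⟨hmem, he⟩, h⟩)
  refine ⟨t, s, c.owner, hrun, ht.trans ?_, hout, I.isEMMSAllocation_of_forall α _ hα fun i => ?_⟩
  · have hn := I.agents_le_size
    have hm := I.items_le_size
    have hN := I.mul_le_size
    -- The polynomial is the running time with `n`, `m`, `m * n` and the numeral length all replaced
    -- by the input size; monotonicity does the rest.
    have heval : timeBound.eval I.size = BagFilling.roundProgTime I.size I.size I.size +
        ((I.size + 1) * ((I.size + 1) * (2 + BagFilling.roundTime I.size I.size + 7) + 2 + 7) +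
          2 + ((I.size + 1) * (BagFilling.roundTime I.size I.size + 7) + 2) + 4) := by
      simp [timeBound, BagFilling.roundProgTime, BagFilling.roundTime]
    rw [heval]
    unfold BagFilling.roundProgTime BagFilling.roundTime
    gcongr
  · have hD : (0 : ℚ) < 2 ^ e := by positivity
    have hlt : ∀ b : Fin I.m, I.m * (i : ℕ) + b < I.m * I.n := fun b => by
      calc I.m * (i : ℕ) + b < I.m * i + I.m := by have := b.2; omega
        _ = I.m * (i + 1) := by ring
        _ ≤ I.m * I.n := Nat.mul_le_mul_left _ i.2
    have hden : ∀ b, (0 : ℚ) < (I.value i b).den := fun b => by exact_mod_cast (I.value i b).pos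
    refine (hsat i).exists_sum_le (V := I.value i) hD (fun b => ?_) fun b => ?_
    · have h := (he _ (hlt b)).1
      rw [hmem0, hmem1] at h
      rw [I.value_eq i b, mul_div_assoc', le_div_iff₀ (hden b), mul_comm (2 ^ e : ℚ)]
      exact_mod_cast h
    · have h := (he _ (hlt b)).2
      rw [hmem0, hmem1] at h
      rw [I.value_eq i b, mul_div_assoc', div_le_iff₀ (hden b), mul_comm (2 ^ e : ℚ), mul_assoc]
      exact_mod_cast h
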